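/- Let $k\ge 1$ be odd. For an integer $r\ge 0$ put $m=r+k$, $\Delta\tau=1/m$, and consider the uniform knots $\tau_i=i\,\Delta\tau$, so that $0=\tau_0<\tau_1<\dots<\tau_m=1$; for $i\in\mathbb Z$ the same formula continues them periodically. Let $S^k$ be the space of $1$-periodic functions of class $C^{k-1}$ that coincide on every interval $(\tau_i,\tau_{i+1})$ with a polynomial of degree at most $k$. Let $B_{s,k}$ ($s\in\mathbb Z$) be the B-splines given by $B_{s,0}=\mathbf 1_{[\tau_s,\tau_{s+1})}$ and $$B_{s,k}(t)=\frac{t-\tau_s}{\tau_{s+k}-\tau_s}B_{s,k-1}(t)+\frac{\tau_{s+k+1}-t}{\tau_{s+k+1}-\tau_{s+1}}B_{s+1,k-1}(t),$$ and let $N_{s,k}=\sum_{j\in\mathbb Z}B_{s+jm,k}$, $0\le s\le m-1$, be the corresponding periodic B-spline basis functions; $N(t)=(N_{0,k}(t),\dots,N_{m-1,k}(t))^T$. Let $u:\mathbb R\to\mathbb R$ be $1$-periodic and of class $C^{k+1}$. Then there is exactly one $\hat u\in S^k$ with $\hat u(\tau_i)=u(\tau_i)$ for $0\le i\le m$ (the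 spline interpolant), and exactly one $\theta^{\rm opt}\in\mathbb R^m$ with $\hat u(t)=N(t)^T\theta^{\rm opt}$ on $[0,1]$. Let $t_1,t_2,\dots$ be independent and uniformly distributed on $[0,1]$. For each $n$, let $\tilde u_i=u(t_i)+\eta_i$, $1\le i\le n$, where, given the $t_i$, the noise variables $\eta_1,\dots,\eta_n$ are independent with law $\mathcal N(0,\delta_\eta^2)$, $\delta_\eta\ge 0$. Let $\tilde U=(\tilde u_1,\dots,\tilde u_n)^T$, let $N_m$ be the $n\times m$ matrix with entries $N_{s,k}(t_i)$, and let $\hat\theta=(N_m^TN_m)^{-1}N_m^T\tilde U$ be the least-squares estimator. $\mathbb E\hat\theta$ and $\mathrm{Cov}\,\hat\theta$ are taken with respect to the noise, for given measurement locations. Then almost surely with respect to the locations there is $n_0$ such that for all $n\ge n_0$ the matrix $N_m^TN_m$ is invertible, $\hat\theta$ is square integrable, and for every $\delta_\eta\ge0$ $$\|\mathbb E\hat\theta-\theta^{\rm opt}\|_2\le C_1\,\Delta\tau^{k+1},\qquad \|\mathrm{Cov}\,\hat\theta\|_2\le C_2\,\frac{\delta_\eta^2}{n},$$ where $\|\cdot\|_2$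 is the Euclidean norm and the operator norm it induces, and $C_1,C_2$ do not depend on $n$, on the sampled locations or on $\delta_\eta$. More precisely $C_1=c_1\,\Delta\tau^{-1/2}$ and $C_2=c_2\,\Delta\tau^{-1}$, with $c_1$ depending only on $k$ and $u$, and $c_2$ depending only on $k$. -/

import Mathlib

open MeasureTheory ProbabilityTheory Filter
open scoped NNReal Matrix

noncomputable section

/-- The uniform knots `τ_i = i / m` of mesh size `1 / m`. Those with `0 ≤ i ≤ m` lie in `[0, 1]`
and satisfy `τ_0 = 0`, `τ_m = 1`; the other ones are their periodic continuation. -/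
def knot (m : ℕ) (i : ℤ) : ℝ := (i : ℝ) / (m : ℝ)

/-- The B-splines of a knot sequence `τ`, by the Cox - de Boor recursion:
`bspline τ k s` is the B-spline of degree `k` with support `[τ_s, τ_(s+k+1)]`. -/
def bspline (τ : ℤ → ℝ) : ℕ → ℤ → ℝ → ℝ
  | 0, s, t => if τ s ≤ t ∧ t < τ (s + 1) then 1 else 0
  | k + 1, s, t =>
      (t - τ s) / (τ (s + (k + 1)) - τ s) * bspline τ k s t
        + (τ (s + (k + 1) + 1) - t) / (τ (s + (k + 1) + 1) - τ (s + 1)) * bspline τ k (s + 1) t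

/-- The `s`-th B-spline basis function of degree `k` of the circle `ℝ / ℤ` with `m` uniform knots:
the sum of all integer translates of the B-spline `bspline (knot m) k s`
(`bspline (knot m) k (s + j * m)` is its translate by `j`). At each point only finitely many
summands are nonzero. -/
def splineBasis (k m : ℕ) (s : Fin m) (t : ℝ) : ℝ :=
  ∑' j : ℤ, bspline (knot m) k ((s : ℤ) + j * (m : ℤ)) t

/-- The space of periodic splines of degree `k` on the `m` uniform knots: functions of period `1`,
of class `C^(k-1)`, equal to a polynomial of degree at most `k` between consecutive knots. -/
def IsPeriodicSpline (k m : ℕ) (p : ℝ → ℝ) : Prop :=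
  Function.Periodic p 1 ∧ ContDiff ℝ ((k - 1 : ℕ) : WithTop ℕ∞) p ∧
    ∀ i : ℤ, ∃ q : Polynomial ℝ, q.natDegree ≤ k ∧
      ∀ t ∈ Set.Ioo (knot m i) (knot m (i + 1)), p t = q.eval t

/-- `p` is a spline interpolant of `u`: a periodic spline with `p (τ_i) = u (τ_i)`, `0 ≤ i ≤ m`. -/
def IsSplineInterpolant (k m : ℕ) (u p : ℝ → ℝ) : Prop :=
  IsPeriodicSpline k m p ∧ ∀ i : ℕ, i ≤ m → p (knot m i) = u (knot m i)

/-- `θ` is a vector of spline coefficients of a spline interpolant of `u`. -/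
def IsInterpolantCoeff (k m : ℕ) (u : ℝ → ℝ) (θ : EuclideanSpace ℝ (Fin m)) : Prop :=
  ∃ p : ℝ → ℝ, IsSplineInterpolant k m u p ∧
    ∀ t ∈ Set.Icc (0 : ℝ) 1, p t = ∑ s, splineBasis k m s t * θ s

/-- The spline basis matrix at the measurement locations `t_1, …, t_n`. -/
def basisMatrix (k m : ℕ) {n : ℕ} (t : Fin n → ℝ) : Matrix (Fin n) (Fin m) ℝ :=
  Matrix.of fun i s => splineBasis k m s (t i)

/-- The least-squares spline coefficients `(Nᵀ N)⁻¹ Nᵀ y` of data `y` at locations `t`. -/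
def lsEstimator (k m : ℕ) {n : ℕ} (t y : Fin n → ℝ) : EuclideanSpace ℝ (Fin m) :=
  WithLp.toLp 2
    ((((basisMatrix k m t)ᵀ * basisMatrix k m t)⁻¹ * (basisMatrix k m t)ᵀ) *ᵥ y)

/-- The covariance matrix of a random vector. -/
def covMatrix {Ω : Type*} [MeasurableSpace Ω] (Q : Measure Ω) {m : ℕ}
    (X : Ω → EuclideanSpace ℝ (Fin m)) : Matrix (Fin m) (Fin m) ℝ :=
  Matrix.of fun a b => covariance (fun ω => X ω a) (fun ω => X ω b) Q

/-- The operator norm of a square matrix for the Euclidean norm. -/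
def matrixNorm2 {m : ℕ} (A : Matrix (Fin m) (Fin m) ℝ) : ℝ :=
  ‖Matrix.toEuclideanCLM (n := Fin m) (𝕜 := ℝ) A‖

end

/-! Everything rests on two deterministic L² estimates, transferred to the random sample by the law
of large numbers.

Stability (`exists_le_integral_sq_splineSum`): on each knot interval only k+1 translates of one
fixed B-spline are active, and they are linearly independent there. Compactness and scaling by m
bound the Gram matrix of the periodic basis below by c/m, with c depending on k only.

Approximation (`PeriodicDerivChain.integral_sq_sub_le`): write k = 2q+1 and let e be the
interpolation error. It vanishes at the knots, so Rolle and Poincaré give ‖e‖ ≤ ((q+1)/m)^(q+1)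
‖e^(q+1)‖. Since the k-th derivative of the spline is piecewise constant, e^(q+1) is orthogonal to
the (q+1)-st derivative of the spline, and integration by parts gives ‖e^(q+1)‖² = ±∫ e u^(k+1).
Together, ‖e‖ = O(m^-(k+1)). With u = 0 the same estimate gives uniqueness of the interpolant, and
existence follows by counting dimensions.

Almost surely, for large n, NᵀN ≥ λ with λ = nc/(2m), and the sum of e(t_i)² is at most n times a
bound of order m^(-2(k+1)). The bias is the least-squares fit of the residuals e(t_i), so its
squared norm is at most λ⁻¹ ∑ e(t_i)². The covariance is δ²(NᵀN)⁻¹, of norm at most δ²/λ. The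
factors Δτ^(-1/2) and Δτ^(-1) come from the 1/m in λ. -/

/-! ### Truncated powers and cardinal B-splines -/

/-- The truncated power `x_+ ^ k`. -/
noncomputable def truncPow (k : ℕ) (x : ℝ) : ℝ := if 0 ≤ x then x ^ k else 0

/-- The cardinal B-spline of degree `k`, with knots at the integers `0, …, k + 1`. -/
noncomputable def cardBspline (k : ℕ) (x : ℝ) : ℝ :=
  (∑ j ∈ Finset.range (k + 2), (-1 : ℝ) ^ j * ((k + 1).choose j : ℝ) * truncPow k (x - j)) /
    (k.factorial : ℝ)

lemma truncPow_succ (k : ℕ) (x : ℝ) : truncPow (k + 1) x = x * truncPow k x := by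
  unfold truncPow
  split_ifs <;> ring

lemma truncPow_of_nonneg (k : ℕ) {x : ℝ} (h : 0 ≤ x) : truncPow k x = x ^ k := if_pos h

lemma truncPow_of_neg (k : ℕ) {x : ℝ} (h : x < 0) : truncPow k x = 0 := if_neg (not_le.2 h)

lemma hasDerivAt_truncPow_of_ne (k : ℕ) {x : ℝ} (hx : x ≠ 0) :
    HasDerivAt (truncPow (k + 1)) ((k + 1) * truncPow k x) x := by
  rcases lt_or_gt_of_ne hx with h | h
  · rw [truncPow_of_neg k h, mul_zero]
    refine (hasDerivAt_const x (0 : ℝ)).congr_of_eventuallyEq ?_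
    filter_upwards [eventually_lt_nhds h] with y hy using truncPow_of_neg _ hy
  · rw [truncPow_of_nonneg k h.le]
    have := hasDerivAt_pow (k + 1) x
    simp only [Nat.cast_add, Nat.cast_one, Nat.add_sub_cancel] at this
    refine this.congr_of_eventuallyEq ?_
    filter_upwards [eventually_gt_nhds h] with y hy using truncPow_of_nonneg _ hy.le

/-- From exponent two on there is no corner at 0, because x^(k+2) = o(x). -/
lemma hasDerivAt_truncPow (k : ℕ) (x : ℝ) :
    HasDerivAt (truncPow (k + 2)) ((k + 2) * truncPow (k + 1) x) x := by
  rcases eq_or_ne x 0 with rfl | h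
  · rw [truncPow_of_nonneg _ le_rfl]
    have h0 : truncPow (k + 2) 0 = 0 := by simp [truncPow]
    rw [hasDerivAt_iff_isLittleO, h0]
    simp only [sub_zero, smul_eq_mul, ne_eq, Nat.add_eq_zero_iff, one_ne_zero, and_false,
      not_false_eq_true, zero_pow, mul_zero]
    have h1 : (fun x : ℝ => x ^ (k + 2)) =o[nhds 0] fun x => x := by
      simpa using Asymptotics.isLittleO_pow_id (𝕜 := ℝ) (n := k + 2) (by omega)
    refine Asymptotics.IsBigO.trans_isLittleO (Asymptotics.isBigO_of_le _ fun x => ?_) h1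
    unfold truncPow
    split_ifs <;> simp
  · have := hasDerivAt_truncPow_of_ne (k + 1) h
    push_cast at this
    convert this using 2
    ring

lemma contDiff_truncPow (k : ℕ) : ContDiff ℝ (k : WithTop ℕ∞) (truncPow (k + 1)) := by
  induction k with
  | zero =>
    have : truncPow (0 + 1) = fun x => max x 0 := by
      ext x
      unfold truncPow
      split_ifs with h
      · simp [h]
      · simp [(not_le.1 h).le]
    rw [this]
    exact contDiff_zero.2 (by fun_prop)
  | succ k ih =>
    push_cast
    rw [contDiff_succ_iff_deriv]
    refine ⟨fun x => (hasDerivAt_truncPow k x).differentiableAt, by simp, ?_⟩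
    rw [show deriv (truncPow (k + 1 + 1)) = fun x => (k + 2) * truncPow (k + 1) x from
      funext fun x => (hasDerivAt_truncPow k x).deriv]
    exact contDiff_const.mul ih

lemma contDiff_cardBspline (k : ℕ) : ContDiff ℝ (k : WithTop ℕ∞) (cardBspline (k + 1)) := by
  unfold cardBspline
  refine ContDiff.div_const (ContDiff.sum fun j _ => contDiff_const.mul ?_) _
  exact (contDiff_truncPow k).comp (contDiff_id.sub contDiff_const)

/-- Splitting an alternating sum with coefficients `choose (k + 2)`. -/
lemma cardBspline_mul_factorial (k : ℕ) (x : ℝ) :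
    cardBspline k x * (k.factorial : ℝ) = truncPow k x + ∑ j ∈ Finset.range (k + 2),
      (-1 : ℝ) ^ (j + 1) * ((k + 1).choose (j + 1) : ℝ) * truncPow k (x - (j + 1)) := by
  have hf : (k.factorial : ℝ) ≠ 0 := by positivity
  -- A term with zero binomial coefficient is appended. Without j = 0 the sum then has the same
  -- range as the one for the shifted spline, and the two can be compared termwise.
  have := Finset.sum_range_succ' (fun j : ℕ =>
    (-1 : ℝ) ^ j * ((k + 1).choose j : ℝ) * truncPow k (x - j)) (k + 2)
  rw [Finset.sum_range_succ, Nat.choose_succ_self] at this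
  rw [cardBspline, div_mul_cancel₀ _ hf]
  simp only [Nat.cast_zero, mul_zero, zero_mul, add_zero, pow_zero, Nat.choose_zero_right,
    Nat.cast_one, one_mul, sub_zero, Nat.cast_add] at this
  rw [this, add_comm]

lemma cardBspline_sub_one_mul_factorial (k : ℕ) (x : ℝ) :
    cardBspline k (x - 1) * (k.factorial : ℝ) = ∑ j ∈ Finset.range (k + 2),
      (-1 : ℝ) ^ j * ((k + 1).choose j : ℝ) * truncPow k (x - (j + 1)) := by
  have hf : (k.factorial : ℝ) ≠ 0 := by positivity
  rw [cardBspline, div_mul_cancel₀ _ hf]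
  refine Finset.sum_congr rfl fun j _ => ?_
  rw [show x - 1 - (j : ℝ) = x - (j + 1) by ring]

/-- Coefficients of each truncated power are compared: `truncPow_succ` extracts the factor x -
(j+1), and the rest is Pascal's rule together with (k+2) C(k+1, j) = (j+1) C(k+2, j+1). -/
lemma cardBspline_succ (k : ℕ) (x : ℝ) :
    cardBspline (k + 1) x = x / (k + 1) * cardBspline k x +
      (k + 2 - x) / (k + 1) * cardBspline k (x - 1) := by
  have hf : (k.factorial : ℝ) ≠ 0 := by positivity
  have key : cardBspline (k + 1) x * ((k + 1).factorial : ℝ) =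
      x * (cardBspline k x * (k.factorial : ℝ)) +
        (k + 2 - x) * (cardBspline k (x - 1) * (k.factorial : ℝ)) := by
    rw [cardBspline_mul_factorial k, cardBspline_sub_one_mul_factorial, cardBspline,
      div_mul_cancel₀ _ (by positivity), Finset.sum_range_succ', mul_add, add_assoc (x * truncPow k x), Finset.mul_sum,
      Finset.mul_sum, ← Finset.sum_add_distrib (s := Finset.range (k + 2)), add_comm]
    congr 1
    · simp [truncPow_succ]
    · refine Finset.sum_congr rfl fun j _ => ?_
      have h1 := Nat.add_one_mul_choose_eq (k + 1) j
      have h2 := Nat.choose_succ_succ (k + 1) j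
      have h1' : ((k : ℝ) + 2) * ((k + 1).choose j : ℝ) = ((k + 2).choose (j + 1) : ℝ) * (j + 1) := by
        have : ((k + 1 + 1 : ℕ) : ℝ) * ((k + 1).choose j : ℝ) =
          ((k + 1 + 1).choose (j + 1) : ℝ) * ((j + 1 : ℕ) : ℝ) := by exact_mod_cast h1
        push_cast at this
        rw [← this]; ring
      have h2' : ((k + 2).choose (j + 1) : ℝ) = ((k + 1).choose j : ℝ) + (k + 1).choose (j + 1) := by
        exact_mod_cast h2
      rw [truncPow_succ]
      push_cast
      rw [show k + 1 + 1 = k + 2 from rfl]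
      have h3 : ((k + 2).choose (j + 1) : ℝ) * (x - (j + 1)) =
          x * (k + 1).choose (j + 1) - (k + 2 - x) * (k + 1).choose j := by
        linear_combination x * h2' + h1'
      linear_combination (-1 : ℝ) ^ (j + 1) * truncPow k (x - (j + 1)) * h3
  rw [Nat.factorial_succ] at key
  push_cast at key
  have : cardBspline (k + 1) x * (k + 1) =
      x * cardBspline k x + (k + 2 - x) * cardBspline k (x - 1) :=
    mul_right_cancel₀ hf (by linear_combination key)
  field_simp
  linear_combination this

/-- The convention 0^0 = 1 makes `truncPow 0` the indicator of [0, ∞), which matches the half-open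
intervals of the recursion. -/
lemma cardBspline_zero (x : ℝ) : cardBspline 0 x = if 0 ≤ x ∧ x < 1 then 1 else 0 := by
  simp only [cardBspline, truncPow, Finset.sum_range_succ, Finset.range_zero, Finset.sum_empty]
  by_cases h0 : 0 ≤ x <;> by_cases h1 : x < 1
  · simp [h0, h1]
  · simp [h0, h1, not_lt.1 h1]
  · simp [h0, h1]
  · exact absurd (not_lt.1 h1) (by linarith)

/-- For uniform knots all B-splines are dilated translates of a single function. This is why the
constant c of the Gram bound does not depend on m. -/
lemma bspline_knot {m : ℕ} (hm : 0 < m) (k : ℕ) (s : ℤ) (t : ℝ) :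
    bspline (knot m) k s t = cardBspline k (m * t - s) := by
  have hm' : (0 : ℝ) < m := by exact_mod_cast hm
  induction k generalizing s with
  | zero =>
    rw [bspline, cardBspline_zero]
    congr 1
    simp only [knot, Int.cast_add, Int.cast_one, eq_iff_iff]
    rw [div_le_iff₀ hm', lt_div_iff₀ hm']
    constructor <;> rintro ⟨h1, h2⟩ <;> constructor <;> linarith
  | succ k ih =>
    rw [bspline, ih, ih, cardBspline_succ]
    have e : (m * t - ((s + 1 : ℤ) : ℝ)) = m * t - s - 1 := by push_cast; ring
    rw [e]
    congr 2
    · simp only [knot]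
      push_cast
      have : ((s + (k + 1) : ℝ) / m - s / m) ≠ 0 := by
        rw [← sub_div]; apply div_ne_zero _ hm'.ne'; ring_nf; linarith
      field_simp
      ring
    · simp only [knot]
      push_cast
      have : ((s + (k + 1) + 1 : ℝ) / m - (s + 1) / m) ≠ 0 := by
        rw [← sub_div]; apply div_ne_zero _ hm'.ne'; ring_nf; linarith
      field_simp
      ring

/-- To the right of k + 1 the truncated powers cancel; induction along the recursion avoids
finite-difference identities. -/
lemma cardBspline_of_notMem (k : ℕ) {x : ℝ} (hx : x < 0 ∨ k + 1 ≤ x) : cardBspline k x = 0 := by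
  induction k generalizing x with
  | zero =>
    rw [cardBspline_zero, if_neg]
    rintro ⟨h1, h2⟩
    rcases hx with h | h <;> norm_num at h <;> linarith
  | succ k ih =>
    push_cast at hx
    rw [cardBspline_succ, ih, ih]
    · simp
    · rcases hx with h | h
      · left; linarith
      · right; linarith
    · rcases hx with h | h
      · left; linarith
      · right; linarith

lemma hasDerivAt_cardBspline (k : ℕ) {x : ℝ} (hx : ∀ j : ℕ, x ≠ j) :
    HasDerivAt (cardBspline (k + 1)) (cardBspline k x - cardBspline k (x - 1)) x := by
  have h1 : HasDerivAt (cardBspline (k + 1)) ((∑ j ∈ Finset.range (k + 3),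
      (-1 : ℝ) ^ j * ((k + 2).choose j : ℝ) * ((k + 1) * truncPow k (x - j))) /
        ((k + 1).factorial : ℝ)) x := by
    unfold cardBspline
    refine HasDerivAt.div_const (HasDerivAt.fun_sum fun j _ => HasDerivAt.const_mul _ ?_) _
    exact (hasDerivAt_truncPow_of_ne k (sub_ne_zero.2 (hx j))).comp_sub_const x (j : ℝ)
  convert h1 using 1
  rw [Nat.factorial_succ, eq_div_iff (by positivity)]
  have key : (cardBspline k x * (k.factorial : ℝ) - cardBspline k (x - 1) * (k.factorial : ℝ)) *
      (k + 1) = ∑ j ∈ Finset.range (k + 3),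
      (-1 : ℝ) ^ j * ((k + 2).choose j : ℝ) * ((k + 1) * truncPow k (x - j)) := by
    rw [cardBspline_mul_factorial k, cardBspline_sub_one_mul_factorial,
      Finset.sum_range_succ' _ (k + 2), add_sub_assoc, ← Finset.sum_sub_distrib, add_mul, Finset.sum_mul, add_comm]
    congr 1
    · refine Finset.sum_congr rfl fun j _ => ?_
      have h2' : ((k + 2).choose (j + 1) : ℝ) = ((k + 1).choose j : ℝ) + (k + 1).choose (j + 1) := by
        exact_mod_cast Nat.choose_succ_succ (k + 1) j
      rw [h2']
      push_cast
      ring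
    · simp; ring
  push_cast
  linear_combination key

/-- In the recursion `cardBspline k (x + l)` receives the weights (x+l)/(k+1) and (k+1-x-l)/(k+1),
whose sum is 1; the two extreme terms vanish by support. -/
lemma sum_cardBspline (k : ℕ) {x : ℝ} (h0 : 0 ≤ x) (h1 : x < 1) :
    ∑ l ∈ Finset.range (k + 1), cardBspline k (x + l) = 1 := by
  induction k with
  | zero => rw [Finset.sum_range_one, cardBspline_zero]; simp [h0, h1]
  | succ k ih =>
    simp only [cardBspline_succ, Finset.sum_add_distrib]
    rw [Finset.sum_range_succ, Finset.sum_range_succ' _ (k + 1),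
      cardBspline_of_notMem k (x := x + ((k + 1 : ℕ) : ℝ)) (by right; push_cast; linarith),
      cardBspline_of_notMem k (x := x + ((0 : ℕ) : ℝ) - 1) (by left; simp; linarith),
      mul_zero, mul_zero, add_zero, add_zero, ← Finset.sum_add_distrib]
    refine Eq.trans ?_ ih
    refine Finset.sum_congr rfl fun l _ => ?_
    push_cast
    rw [show x + (l + 1 : ℝ) - 1 = x + l by ring]
    field_simp
    ring

/-- The cardinal B-splines that do not vanish on `(0, 1)` are linearly independent there. -/
lemma cardBspline_linearIndependent (k : ℕ) (c : ℕ → ℝ)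
    (h : ∀ x ∈ Set.Ioo (0 : ℝ) 1, ∑ l ∈ Finset.range (k + 1), c l * cardBspline k (x + l) = 0) :
    ∀ l ≤ k, c l = 0 := by
  induction k generalizing c with
  | zero =>
    have := h (1 / 2) (by norm_num)
    norm_num [cardBspline_zero] at this
    intro l hl
    rw [Nat.le_zero.1 hl, this]
  | succ k ih =>
    -- Differentiation lowers the degree and turns the coefficients into differences. By induction
    -- all c l agree, and the partition of unity then forces the common value to be 0.
    have hd : ∀ x ∈ Set.Ioo (0 : ℝ) 1,
        ∑ l ∈ Finset.range (k + 1), (c l - c (l + 1)) * cardBspline k (x + l) = 0 := by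
      intro x hx
      have h1 : HasDerivAt (fun x => ∑ l ∈ Finset.range (k + 2), c l * cardBspline (k + 1) (x + l))
          (∑ l ∈ Finset.range (k + 2),
            c l * (cardBspline k (x + l) - cardBspline k (x + l - 1))) x := by
        refine HasDerivAt.fun_sum fun l _ => HasDerivAt.const_mul _ ?_
        refine (hasDerivAt_cardBspline k fun j hj => ?_).comp_add_const x (l : ℝ)
        have h3 : (l : ℝ) < j := by linarith [hx.1]
        have h4 : (j : ℝ) < l + 1 := by linarith [hx.2]
        have h5 : l < j := by exact_mod_cast h3
        have h6 : j < l + 1 := by exact_mod_cast h4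
        omega
      have h2 : HasDerivAt (fun x => ∑ l ∈ Finset.range (k + 2), c l * cardBspline (k + 1) (x + l))
          0 x := by
        refine (hasDerivAt_const x (0 : ℝ)).congr_of_eventuallyEq ?_
        filter_upwards [Ioo_mem_nhds hx.1 hx.2] with y hy using h y hy
      have h3 := h1.unique h2
      simp only [mul_sub, Finset.sum_sub_distrib] at h3
      rw [Finset.sum_range_succ, Finset.sum_range_succ' _ (k + 1),
        cardBspline_of_notMem k (x := x + ((k + 1 : ℕ) : ℝ)) (by right; push_cast; linarith [hx.1]),
        cardBspline_of_notMem k (x := x + ((0 : ℕ) : ℝ) - 1) (by left; simp; linarith [hx.2]),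
        mul_zero, mul_zero, add_zero, add_zero, ← Finset.sum_sub_distrib] at h3
      rw [← h3]
      refine Finset.sum_congr rfl fun l _ => ?_
      push_cast
      rw [show x + (l + 1 : ℝ) - 1 = x + l by ring]
      ring
    have hc : ∀ l ≤ k, c l = c (l + 1) := fun l hl =>
      sub_eq_zero.1 (ih (fun l => c l - c (l + 1)) hd l hl)
    have hc0 : ∀ l ≤ k + 1, c l = c 0 := by
      intro l
      induction l with
      | zero => simp
      | succ l ihl => intro hl; rw [← hc l (by omega), ihl (by omega)]
    have h0 : c 0 = 0 := by
      have h1 := h (1 / 2) (by norm_num)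
      rw [Finset.sum_congr rfl (g := fun l => c 0 * cardBspline (k + 1) (1 / 2 + (l : ℕ))),
        ← Finset.mul_sum, sum_cardBspline _ (by norm_num) (by norm_num), mul_one] at h1
      · exact h1
      · intro l hl
        rw [hc0 l (by have := Finset.mem_range.1 hl; omega)]
    intro l hl
    rw [hc0 l hl, h0]

/-! ### Periodic B-splines -/

/-- The residue of an integer modulo `m`, as an element of `Fin m`. -/
def finMod {m : ℕ} (hm : 0 < m) (n : ℤ) : Fin m :=
  ⟨(n % (m : ℤ)).toNat, by
    have h1 := Int.emod_nonneg n (b := (m : ℤ)) (by omega)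
    have h2 := Int.emod_lt_of_pos n (b := (m : ℤ)) (by omega)
    omega⟩

lemma finMod_eq_iff {m : ℕ} (hm : 0 < m) (n : ℤ) (s : Fin m) :
    finMod hm n = s ↔ ∃ j : ℤ, (s : ℤ) + j * m = n := by
  have h1 := Int.emod_nonneg n (b := (m : ℤ)) (by omega)
  have hs := s.2
  rw [Fin.ext_iff]
  constructor
  · intro h
    have h3 : n % (m : ℤ) = (s : ℕ) := by
      rw [← h]; simp [finMod, h1]
    exact ⟨n / m, by rw [← h3, mul_comm]; exact Int.emod_add_mul_ediv n m⟩
  · rintro ⟨j, rfl⟩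
    simp only [finMod, Int.add_mul_emod_self_right]
    rw [Int.emod_eq_of_lt (by omega) (by omega)]
    simp

lemma finMod_natCast {m : ℕ} (hm : 0 < m) (s : Fin m) : finMod hm ((s : ℕ) : ℤ) = s :=
  (finMod_eq_iff hm _ s).2 ⟨0, by simp⟩

lemma splineBasis_eq_sum {m : ℕ} (hm : 0 < m) (k : ℕ) (s : Fin m) (t : ℝ) (F : Finset ℤ)
    (hF : ∀ n ∉ F, cardBspline k (m * t - (n : ℤ)) = 0) :
    splineBasis k m s t =
      ∑ n ∈ F, if finMod hm n = s then cardBspline k (m * t - (n : ℤ)) else 0 := by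
  have hinj : Function.Injective fun j : ℤ => (s : ℤ) + j * m := fun a b h => by
    simpa [hm.ne'] using h
  have h1 := hinj.tsum_eq
    (f := fun n : ℤ => if finMod hm n = s then cardBspline k (m * t - (n : ℤ)) else 0) (by
      intro n hn
      rw [Function.mem_support] at hn
      have : finMod hm n = s := by
        by_contra h
        simp [h] at hn
      exact (finMod_eq_iff hm n s).1 this)
  have h2 : (∑' n : ℤ, if finMod hm n = s then cardBspline k (m * t - (n : ℤ)) else 0) =
      ∑ n ∈ F, if finMod hm n = s then cardBspline k (m * t - (n : ℤ)) else 0 :=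
    tsum_eq_sum fun n hn => by simp [hF n hn]
  rw [splineBasis, ← h2, ← h1]
  refine tsum_congr fun j => ?_
  rw [bspline_knot hm, if_pos ((finMod_eq_iff hm _ s).2 ⟨j, rfl⟩)]

/-- The periodic spline with coefficients `θ`. -/
noncomputable def splineSum (k m : ℕ) (θ : Fin m → ℝ) (t : ℝ) : ℝ := ∑ s, splineBasis k m s t * θ s

/-- A periodic spline is a sum of integer translates with coefficients periodic in n. Taking a = b
leaves the k + 1 active translates of one knot interval; a < b gives a formula valid across knots.
-/
lemma splineSum_eq_sum {m : ℕ} (hm : 0 < m) (k : ℕ) (θ : Fin m → ℝ) (t : ℝ) {a b : ℤ}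
    (ha : (a : ℝ) ≤ m * t) (hb : m * t < b + 1) :
    splineSum k m θ t =
      ∑ n ∈ Finset.Icc (a - k) b, θ (finMod hm n) * cardBspline k (m * t - (n : ℤ)) := by
  have hF : ∀ n ∉ Finset.Icc (a - k) b, cardBspline k (m * t - (n : ℤ)) = 0 := by
    intro n hn
    apply cardBspline_of_notMem
    rw [Finset.mem_Icc, not_and_or, not_le, not_le] at hn
    rcases hn with h | h
    · right
      have : (n : ℝ) + 1 ≤ a - k := by exact_mod_cast h
      linarith
    · left
      have : (b : ℝ) + 1 ≤ n := by exact_mod_cast h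
      linarith
  unfold splineSum
  simp only [splineBasis_eq_sum hm k _ t _ hF, Finset.sum_mul]
  rw [Finset.sum_comm]
  refine Finset.sum_congr rfl fun n _ => ?_
  simp [mul_comm]

lemma periodic_splineBasis {m : ℕ} (hm : 0 < m) (k : ℕ) (s : Fin m) :
    Function.Periodic (splineBasis k m s) 1 := by
  intro t
  unfold splineBasis
  simp only [bspline_knot hm]
  rw [← (Equiv.addRight (1 : ℤ)).tsum_eq]
  refine tsum_congr fun j => ?_
  simp only [Equiv.coe_addRight]
  push_cast
  congr 1
  ring

lemma contDiff_splineSum {m : ℕ} (hm : 0 < m) (k : ℕ) (θ : Fin m → ℝ) :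
    ContDiff ℝ (k : WithTop ℕ∞) (splineSum (k + 1) m θ) := by
  rw [contDiff_iff_contDiffAt]
  intro t₀
  -- One unit of slack on each side keeps this finite sum valid in a neighbourhood of t₀, also when
  -- t₀ is a knot.
  have h1 : ContDiff ℝ (k : WithTop ℕ∞) fun t : ℝ =>
      ∑ n ∈ Finset.Icc (⌊m * t₀⌋ - 1 - ((k + 1 : ℕ) : ℤ)) (⌊m * t₀⌋ + 1),
        θ (finMod hm n) * cardBspline (k + 1) (m * t - (n : ℤ)) :=
    ContDiff.sum fun n _ => contDiff_const.mul
      ((contDiff_cardBspline k).comp ((contDiff_const.mul contDiff_id).sub contDiff_const))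
  refine h1.contDiffAt.congr_of_eventuallyEq ?_
  have hc : ContinuousAt (fun t : ℝ => m * t) t₀ := by fun_prop
  have h2 := Int.floor_le (m * t₀)
  have h3 := Int.lt_floor_add_one (m * t₀)
  filter_upwards [hc.eventually (lt_mem_nhds (show (⌊m * t₀⌋ : ℝ) - 1 < m * t₀ by linarith)),
    hc.eventually (gt_mem_nhds (show m * t₀ < (⌊m * t₀⌋ : ℝ) + 1 + 1 by linarith))] with t ht1 ht2
  exact splineSum_eq_sum hm (k + 1) θ t (by push_cast; exact ht1.le) (by push_cast; exact ht2)

lemma cardBspline_eq_eval (k : ℕ) (l : ℤ) : ∃ q : Polynomial ℝ, q.natDegree ≤ k ∧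
    ∀ x ∈ Set.Ioo (l : ℝ) (l + 1), cardBspline k x = q.eval x := by
  refine ⟨∑ j ∈ Finset.range (k + 2), Polynomial.C ((-1 : ℝ) ^ j * ((k + 1).choose j : ℝ) *
    (if (j : ℤ) ≤ l then 1 else 0) / (k.factorial : ℝ)) *
      (Polynomial.X - Polynomial.C (j : ℝ)) ^ k, ?_, fun x hx => ?_⟩
  · refine Polynomial.natDegree_sum_le_of_forall_le _ _ fun j _ => ?_
    refine (Polynomial.natDegree_C_mul_le _ _).trans ?_
    rw [Polynomial.natDegree_pow, Polynomial.natDegree_X_sub_C, mul_one]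
  · rw [cardBspline, Finset.sum_div, Polynomial.eval_finsetSum]
    refine Finset.sum_congr rfl fun j _ => ?_
    simp only [Polynomial.eval_mul, Polynomial.eval_C, Polynomial.eval_pow, Polynomial.eval_sub,
      Polynomial.eval_X]
    have : truncPow k (x - j) = (if (j : ℤ) ≤ l then 1 else 0) * (x - j) ^ k := by
      split_ifs with h
      · have : (j : ℝ) ≤ l := by exact_mod_cast h
        rw [truncPow_of_nonneg _ (by linarith [hx.1]), one_mul]
      · have : (l : ℝ) + 1 ≤ j := by exact_mod_cast not_le.1 h
        rw [truncPow_of_neg _ (by linarith [hx.2]), zero_mul]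
    rw [this]
    ring

lemma mem_Ioo_knot_iff {m : ℕ} (hm : 0 < m) (i : ℤ) (t : ℝ) :
    t ∈ Set.Ioo (knot m i) (knot m (i + 1)) ↔ (i : ℝ) < m * t ∧ m * t < i + 1 := by
  have hm' : (0 : ℝ) < m := by exact_mod_cast hm
  simp only [knot, Set.mem_Ioo, div_lt_iff₀ hm', lt_div_iff₀ hm', Int.cast_add, Int.cast_one,
    mul_comm t]

lemma isPeriodicSpline_splineSum {m : ℕ} (hm : 0 < m) {k : ℕ} (hk : 0 < k) (θ : Fin m → ℝ) :
    IsPeriodicSpline k m (splineSum k m θ) := by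
  obtain ⟨k, rfl⟩ : ∃ k', k = k' + 1 := ⟨k - 1, by omega⟩
  refine ⟨fun t => ?_, contDiff_splineSum hm k θ, fun i => ?_⟩
  · simp only [splineSum, periodic_splineBasis hm (k + 1) _ t]
  · choose q hq1 hq2 using cardBspline_eq_eval (k + 1)
    refine ⟨∑ n ∈ Finset.Icc (i - ((k + 1 : ℕ) : ℤ)) i, Polynomial.C (θ (finMod hm n)) *
      (q (i - n)).comp (Polynomial.C (m : ℝ) * Polynomial.X - Polynomial.C (n : ℝ)), ?_, ?_⟩
    · refine Polynomial.natDegree_sum_le_of_forall_le _ _ fun n _ => ?_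
      refine (Polynomial.natDegree_C_mul_le _ _).trans (Polynomial.natDegree_comp_le.trans ?_)
      have : (Polynomial.C (m : ℝ) * Polynomial.X - Polynomial.C (n : ℝ)).natDegree ≤ 1 := by
        rw [Polynomial.natDegree_sub_C]
        exact (Polynomial.natDegree_C_mul_le _ _).trans Polynomial.natDegree_X_le
      calc _ ≤ (k + 1) * 1 := Nat.mul_le_mul (hq1 _) this
        _ = _ := mul_one _
    · intro t ht
      rw [mem_Ioo_knot_iff hm] at ht
      rw [splineSum_eq_sum hm (k + 1) θ t ht.1.le ht.2, Polynomial.eval_finsetSum]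
      refine Finset.sum_congr rfl fun n _ => ?_
      rw [hq2 (i - n)]
      · simp
      · push_cast
        constructor <;> linarith [ht.1, ht.2]

lemma continuous_cardBspline {k : ℕ} (hk : 0 < k) : Continuous (cardBspline k) := by
  obtain ⟨k, rfl⟩ : ∃ k', k = k' + 1 := ⟨k - 1, by omega⟩
  exact (contDiff_cardBspline k).continuous

lemma continuous_splineSum {m : ℕ} (hm : 0 < m) {k : ℕ} (hk : 0 < k) (θ : Fin m → ℝ) :
    Continuous (splineSum k m θ) := by
  obtain ⟨k, rfl⟩ : ∃ k', k = k' + 1 := ⟨k - 1, by omega⟩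
  exact (contDiff_splineSum hm k θ).continuous

lemma continuous_splineBasis {m : ℕ} (hm : 0 < m) {k : ℕ} (hk : 0 < k) (s : Fin m) :
    Continuous (splineBasis k m s) := by
  convert continuous_splineSum hm hk (Pi.single s 1) using 1
  ext t
  simp [splineSum, Pi.single_apply]

/-! ### Lower bound for the Gram matrix -/

/-- By linear independence the integral is a positive definite quadratic form, so compactness of the
unit sphere and homogeneity bound it below. Retaining only `a 0` is enough: on the i-th knot
interval it will be θ i, so a sum over intervals meets each coefficient once. -/
lemma exists_le_integral_sq_sum_cardBspline {k : ℕ} (hk : 0 < k) :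
    ∃ c : ℝ, 0 < c ∧ ∀ a : Fin (k + 1) → ℝ, c * a 0 ^ 2 ≤
      ∫ x in (0 : ℝ)..1, (∑ l, a l * cardBspline k (x + (l : ℕ))) ^ 2 := by
  set Q : (Fin (k + 1) → ℝ) → ℝ := fun a =>
    ∫ x in (0 : ℝ)..1, (∑ l, a l * cardBspline k (x + (l : ℕ))) ^ 2 with hQ
  have hb := continuous_cardBspline hk
  have hQe : Q = fun a => ∑ l : Fin (k + 1), ∑ l' : Fin (k + 1), a l * a l' *
      ∫ x in (0 : ℝ)..1, cardBspline k (x + (l : ℕ)) * cardBspline k (x + (l' : ℕ)) := by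
    ext a
    simp only [hQ, sq, Finset.sum_mul_sum]
    rw [intervalIntegral.integral_finsetSum fun l _ =>
      Continuous.intervalIntegrable (by fun_prop) _ _]
    refine Finset.sum_congr rfl fun l _ => ?_
    rw [intervalIntegral.integral_finsetSum fun l _ =>
      Continuous.intervalIntegrable (by fun_prop) _ _]
    refine Finset.sum_congr rfl fun l' _ => ?_
    rw [← intervalIntegral.integral_const_mul]
    congr 1
    ext x
    ring
  have hQc : Continuous Q := by rw [hQe]; fun_prop
  have hpos : ∀ a, a ≠ 0 → 0 < Q a := by
    intro a ha
    by_contra hle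
    apply ha
    have h0 : ∀ x ∈ Set.Ioo (0 : ℝ) 1,
        ∑ l ∈ Finset.range (k + 1), (fun l => if h : l < k + 1 then a ⟨l, h⟩ else 0) l *
          cardBspline k (x + l) = 0 := by
      intro x hx
      by_contra hne
      apply hle
      refine intervalIntegral.integral_pos zero_lt_one (by fun_prop) (fun y _ => sq_nonneg _)
        ⟨x, Set.Ioo_subset_Icc_self hx, ?_⟩
      rw [Finset.sum_range] at hne
      simp only [Fin.is_lt, dite_true] at hne
      positivity
    ext l
    have := cardBspline_linearIndependent k _ h0 l (Nat.lt_succ_iff.1 l.2)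
    simp only [Fin.is_lt, dite_true] at this
    exact this
  obtain ⟨a₀, ha₀, hmin⟩ := (isCompact_sphere (0 : Fin (k + 1) → ℝ) 1).exists_isMinOn
    (NormedSpace.sphere_nonempty.2 zero_le_one) hQc.continuousOn
  have ha₀' : ‖a₀‖ = 1 := by simpa using ha₀
  refine ⟨Q a₀, hpos _ fun h => by simp [h] at ha₀', fun a => ?_⟩
  rcases eq_or_ne a 0 with rfl | ha
  · simp
  have hn : ‖a‖ ≠ 0 := norm_ne_zero_iff.2 ha
  have h1 : Q a₀ ≤ Q (‖a‖⁻¹ • a) := hmin (by simp [norm_smul, hn])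
  have h2 : Q (‖a‖⁻¹ • a) = (‖a‖⁻¹) ^ 2 * Q a := by
    simp only [hQ, Pi.smul_apply, smul_eq_mul, mul_assoc, ← Finset.mul_sum, mul_pow]
    rw [intervalIntegral.integral_const_mul]
  rw [h2] at h1
  have h3 : a 0 ^ 2 ≤ ‖a‖ ^ 2 := by
    rw [← sq_abs, ← Real.norm_eq_abs]
    exact pow_le_pow_left₀ (norm_nonneg _) (norm_le_pi_norm a 0) 2
  have h4 : 0 < Q a₀ := hpos _ fun h => by simp [h] at ha₀'
  calc Q a₀ * a 0 ^ 2 ≤ Q a₀ * ‖a‖ ^ 2 := by gcongr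
    _ ≤ ((‖a‖⁻¹) ^ 2 * Q a) * ‖a‖ ^ 2 := by gcongr
    _ = Q a := by field_simp

/-- A lower bound for the Gram matrix of the periodic B-splines. -/
lemma exists_le_integral_sq_splineSum {k : ℕ} (hk : 0 < k) :
    ∃ c : ℝ, 0 < c ∧ ∀ (m : ℕ), 0 < m → ∀ θ : Fin m → ℝ,
      c / m * ∑ s, θ s ^ 2 ≤ ∫ t in (0 : ℝ)..1, splineSum k m θ t ^ 2 := by
  obtain ⟨c, hc, h⟩ := exists_le_integral_sq_sum_cardBspline hk
  refine ⟨c, hc, fun m hm θ => ?_⟩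
  have hm' : (0 : ℝ) < m := by exact_mod_cast hm
  have hS := continuous_splineSum hm hk θ
  have h1 := intervalIntegral.sum_integral_adjacent_intervals (μ := volume)
    (f := fun t => splineSum k m θ t ^ 2) (a := fun i : ℕ => (i : ℝ) / m) (n := m)
    (fun i _ => Continuous.intervalIntegrable (by fun_prop) _ _)
  simp only [Nat.cast_zero, zero_div, div_self hm'.ne'] at h1
  rw [← h1, Finset.sum_range, Finset.mul_sum]
  refine Finset.sum_le_sum fun i _ => ?_
  -- For m ≤ k some of these indices coincide modulo m. This is harmless, since the local bound
  -- holds for arbitrary coefficients.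
  have h2 := h fun l => θ (finMod hm ((i : ℕ) - (l : ℕ)))
  simp only [Fin.val_zero, Nat.cast_zero, sub_zero, finMod_natCast] at h2
  have h3 : ∀ x ∈ Set.Ico (0 : ℝ) 1, splineSum k m θ (x / m + (i : ℕ) / m) =
      ∑ l : Fin (k + 1), θ (finMod hm ((i : ℕ) - (l : ℕ))) * cardBspline k (x + (l : ℕ)) := by
    intro x hx
    have e : (m : ℝ) * (x / m + (i : ℕ) / m) = x + (i : ℕ) := by field_simp
    rw [splineSum_eq_sum hm k θ _ (a := (i : ℕ)) (b := (i : ℕ)) (by rw [e]; simp [hx.1])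
      (by rw [e]; push_cast; linarith [hx.2]), e]
    refine (Finset.sum_bij (fun (l : Fin (k + 1)) _ => ((i : ℕ) : ℤ) - (l : ℕ)) ?_ ?_ ?_ ?_).symm
    · intro l _
      have := l.2
      rw [Finset.mem_Icc]
      omega
    · intro a _ b _ hab
      ext
      omega
    · intro n hn
      rw [Finset.mem_Icc] at hn
      exact ⟨⟨((i : ℕ) - n).toNat, by omega⟩, Finset.mem_univ _, by simp; omega⟩
    · intro l _
      push_cast
      congr 2
      ring
  have h4 : ∫ t in ((i : ℕ) : ℝ) / m..((i + 1 : ℕ) : ℝ) / m, splineSum k m θ t ^ 2 =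
      (m : ℝ)⁻¹ * ∫ x in (0 : ℝ)..1,
        (∑ l : Fin (k + 1), θ (finMod hm ((i : ℕ) - (l : ℕ))) * cardBspline k (x + (l : ℕ))) ^ 2 := by
    have h5 := intervalIntegral.integral_comp_div_add (a := 0) (b := 1)
      (fun t => splineSum k m θ t ^ 2) hm'.ne' (((i : ℕ) : ℝ) / m)
    rw [zero_div, zero_add, ← add_div, add_comm (1 : ℝ), smul_eq_mul] at h5
    push_cast
    rw [eq_inv_mul_iff_mul_eq₀ hm'.ne', ← h5]
    refine intervalIntegral.integral_congr_ae ?_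
    have : ∀ᵐ x : ℝ, x ≠ 1 := by simp [ae_iff]
    filter_upwards [this] with x hx1 hx
    rw [Set.uIoc_of_le zero_le_one] at hx
    rw [h3 x ⟨hx.1.le, lt_of_le_of_ne hx.2 hx1⟩]
  rw [h4, div_eq_inv_mul, mul_assoc]
  gcongr

/-! ### Integration of piecewise continuous functions -/

lemma knot_lt_knot_succ {m : ℕ} (hm : 0 < m) (i : ℤ) : knot m i < knot m (i + 1) := by
  have hm' : (0 : ℝ) < m := by exact_mod_cast hm
  unfold knot
  push_cast
  gcongr
  linarith

lemma knot_mono {m : ℕ} : Monotone (knot m) := by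
  intro i j hij
  have : (i : ℝ) ≤ j := by exact_mod_cast hij
  unfold knot
  gcongr

lemma knot_add_sub {m : ℕ} (i : ℤ) (n : ℕ) : knot m (i + n) - knot m i = n / m := by
  unfold knot
  push_cast
  ring

/-- Functions that coincide with a continuous function on each open interval between
consecutive knots. -/
def PiecewiseContinuous (m : ℕ) (f : ℝ → ℝ) : Prop :=
  ∀ i : ℤ, ∃ g : ℝ → ℝ, Continuous g ∧ ∀ t ∈ Set.Ioo (knot m i) (knot m (i + 1)), f t = g t

lemma Continuous.piecewiseContinuous {f : ℝ → ℝ} (hf : Continuous f) (m : ℕ) :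
    PiecewiseContinuous m f := fun _ => ⟨f, hf, fun _ _ => rfl⟩

namespace PiecewiseContinuous

variable {m : ℕ} {f g : ℝ → ℝ}

lemma mul (hf : PiecewiseContinuous m f) (hg : PiecewiseContinuous m g) :
    PiecewiseContinuous m fun t => f t * g t := fun i => by
  obtain ⟨f', hf1, hf2⟩ := hf i
  obtain ⟨g', hg1, hg2⟩ := hg i
  exact ⟨fun t => f' t * g' t, by fun_prop, fun t ht => by simp only [hf2 t ht, hg2 t ht]⟩

lemma sub (hf : PiecewiseContinuous m f) (hg : PiecewiseContinuous m g) :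
    PiecewiseContinuous m fun t => f t - g t := fun i => by
  obtain ⟨f', hf1, hf2⟩ := hf i
  obtain ⟨g', hg1, hg2⟩ := hg i
  exact ⟨fun t => f' t - g' t, by fun_prop, fun t ht => by simp only [hf2 t ht, hg2 t ht]⟩

lemma sq (hf : PiecewiseContinuous m f) : PiecewiseContinuous m fun t => f t ^ 2 := by
  simpa only [pow_two] using hf.mul hf

lemma intervalIntegrable_knot_succ (hf : PiecewiseContinuous m f) (i : ℤ) :
    IntervalIntegrable f volume (knot m i) (knot m (i + 1)) := by
  obtain ⟨f', hf1, hf2⟩ := hf i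
  have h := hf1.intervalIntegrable (μ := volume) (knot m i) (knot m (i + 1))
  have hle : knot m i ≤ knot m (i + 1) := knot_mono (by omega)
  rw [intervalIntegrable_iff_integrableOn_Ioo_of_le hle] at h ⊢
  exact h.congr_fun (fun t ht => (hf2 t ht).symm) measurableSet_Ioo

lemma intervalIntegrable_knot (hf : PiecewiseContinuous m f) (i : ℤ) (n : ℕ) :
    IntervalIntegrable f volume (knot m i) (knot m (i + n)) := by
  have := IntervalIntegrable.trans_iterate (μ := volume) (f := f)
    (a := fun l : ℕ => knot m (i + l)) (n := n) (fun l _ => by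
      have := hf.intervalIntegrable_knot_succ (i + l)
      push_cast
      rwa [← add_assoc])
  simpa using this

lemma intervalIntegrable_unit (hf : PiecewiseContinuous m f) (hm : 0 < m) :
    IntervalIntegrable f volume 0 1 := by
  have := hf.intervalIntegrable_knot 0 m
  simpa [knot, hm.ne'] using this

lemma sum_integral (hf : PiecewiseContinuous m f) (i : ℤ) (n : ℕ) :
    ∑ l ∈ Finset.range n, ∫ t in knot m (i + l)..knot m (i + l + 1), f t =
      ∫ t in knot m i..knot m (i + n), f t := by
  have := intervalIntegral.sum_integral_adjacent_intervals (μ := volume) (f := f)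
    (a := fun l : ℕ => knot m (i + l)) (n := n) (fun l _ => by
      have := hf.intervalIntegrable_knot_succ (i + l)
      push_cast
      rwa [← add_assoc])
  simpa [← add_assoc] using this

lemma sum_integral_period (hf : PiecewiseContinuous m f) (hp : Function.Periodic f 1)
    (hm : 0 < m) (i : ℤ) :
    ∑ l ∈ Finset.range m, ∫ t in knot m (i + l)..knot m (i + l + 1), f t =
      ∫ t in (0 : ℝ)..1, f t := by
  have hm' : (m : ℝ) ≠ 0 := by exact_mod_cast hm.ne'
  rw [hf.sum_integral i m]
  have : knot m (i + m) = knot m i + 1 := by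
    unfold knot
    push_cast
    field_simp
  rw [this, hp.intervalIntegral_add_eq (knot m i) 0, zero_add]

end PiecewiseContinuous

/-- Cauchy–Schwarz against the constant 1, obtained by expanding the integral of the square of (b-a)
f - I. -/
lemma sq_intervalIntegral_le {a b : ℝ} (hab : a ≤ b) {f : ℝ → ℝ}
    (hf : IntervalIntegrable f volume a b)
    (hf2 : IntervalIntegrable (fun t => f t ^ 2) volume a b) :
    (∫ t in a..b, f t) ^ 2 ≤ (b - a) * ∫ t in a..b, f t ^ 2 := by
  rcases hab.eq_or_lt with rfl | hlt
  · simp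
  set I := ∫ t in a..b, f t
  have h0 : 0 ≤ ∫ t in a..b, ((b - a) * f t - I) ^ 2 :=
    intervalIntegral.integral_nonneg hab fun t _ => sq_nonneg _
  have h1 : ∫ t in a..b, ((b - a) * f t - I) ^ 2 =
      (b - a) ^ 2 * (∫ t in a..b, f t ^ 2) - 2 * (b - a) * I * I + (b - a) * I ^ 2 := by
    have : ∀ t, ((b - a) * f t - I) ^ 2 =
        (b - a) ^ 2 * f t ^ 2 - 2 * (b - a) * I * f t + I ^ 2 := fun t => by ring
    simp only [this]
    rw [intervalIntegral.integral_add ((hf2.const_mul _).sub (hf.const_mul _))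
      intervalIntegrable_const, intervalIntegral.integral_sub (hf2.const_mul _) (hf.const_mul _),
      intervalIntegral.integral_const_mul, intervalIntegral.integral_const_mul,
      intervalIntegral.integral_const, smul_eq_mul]
  rw [h1] at h0
  have h2 : 0 < b - a := sub_pos.2 hlt
  have h3 : 0 ≤ (b - a) * ((b - a) * (∫ t in a..b, f t ^ 2) - I ^ 2) := by
    linear_combination h0
  have := nonneg_of_mul_nonneg_right h3 h2
  linarith

lemma sq_intervalIntegral_le_of_mem {a b x z : ℝ} {f : ℝ → ℝ} (hx : x ∈ Set.Icc a b)
    (hz : z ∈ Set.Icc a b) (hf : IntervalIntegrable f volume a b)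
    (hf2 : IntervalIntegrable (fun t => f t ^ 2) volume a b) :
    (∫ t in z..x, f t) ^ 2 ≤ (b - a) * ∫ t in a..b, f t ^ 2 := by
  wlog hzx : z ≤ x generalizing x z
  · rw [intervalIntegral.integral_symm, neg_sq]
    exact this hz hx (le_of_not_ge hzx)
  have hab : a ≤ b := hx.1.trans hx.2
  have hsub : Set.uIcc z x ⊆ Set.uIcc a b := by
    rw [Set.uIcc_of_le hzx, Set.uIcc_of_le hab]
    exact Set.Icc_subset_Icc hz.1 hx.2
  have h0 : 0 ≤ ∫ t in z..x, f t ^ 2 := intervalIntegral.integral_nonneg hzx fun t _ => sq_nonneg _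
  calc (∫ t in z..x, f t) ^ 2 ≤ (x - z) * ∫ t in z..x, f t ^ 2 :=
        sq_intervalIntegral_le hzx (hf.mono_set hsub) (hf2.mono_set hsub)
    _ ≤ (b - a) * ∫ t in a..b, f t ^ 2 := by
        refine mul_le_mul (by linarith [hx.2, hz.1]) ?_ h0 (by linarith)
        exact intervalIntegral.integral_mono_interval hz.1 hzx hx.2
          (Filter.Eventually.of_forall fun t => sq_nonneg _) hf2

/-! ### Periodic derivative chains and the energy method -/

lemma countable_range_knot (m : ℕ) : (Set.range (knot m)).Countable := Set.countable_range _

/-- Integration by parts over a period, with derivatives that may fail to exist at the knots. -/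
lemma integral_deriv_mul_eq_neg {m : ℕ} (hm : 0 < m) {f f' g g' : ℝ → ℝ}
    (hf : Continuous f) (hg : Continuous g) (hfp : Function.Periodic f 1)
    (hgp : Function.Periodic g 1) (hf' : PiecewiseContinuous m f')
    (hg' : PiecewiseContinuous m g')
    (hfd : ∀ x ∉ Set.range (knot m), HasDerivAt f (f' x) x)
    (hgd : ∀ x ∉ Set.range (knot m), HasDerivAt g (g' x) x) :
    ∫ t in (0 : ℝ)..1, f' t * g t = -∫ t in (0 : ℝ)..1, f t * g' t := by
  have h1 := (hf'.mul (hg.piecewiseContinuous m)).intervalIntegrable_unit hm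
  have h2 := ((hf.piecewiseContinuous m).mul hg').intervalIntegrable_unit hm
  have h3 := integral_eq_of_hasDerivAt_off_countable (a := 0) (b := 1) (fun t => f t * g t)
    (fun t => f' t * g t + f t * g' t) (countable_range_knot m) (by fun_prop)
    (fun x hx => (hfd x hx.2).mul (hgd x hx.2)) (h1.add h2)
  rw [intervalIntegral.integral_add h1 h2] at h3
  have h4 := hfp 0
  have h5 := hgp 0
  rw [zero_add] at h4 h5
  rw [h4, h5, sub_self] at h3
  linarith

/-- A periodic function `f 0` together with its derivatives `f 1, …, f N`, the last of which
exists off the knots only. -/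
structure PeriodicDerivChain (m N : ℕ) (f : ℕ → ℝ → ℝ) : Prop where
  periodic : ∀ j, Function.Periodic (f j) 1
  continuous : ∀ j < N, Continuous (f j)
  piecewise : PiecewiseContinuous m (f N)
  hasDerivAt : ∀ j, j + 1 < N → ∀ x, HasDerivAt (f j) (f (j + 1) x) x
  hasDerivAt_off_knots : ∀ j < N, ∀ x ∉ Set.range (knot m), HasDerivAt (f j) (f (j + 1) x) x

namespace PeriodicDerivChain

variable {m N : ℕ} {f g : ℕ → ℝ → ℝ}

lemma piecewise_of_le (hf : PeriodicDerivChain m N f) {j : ℕ} (hj : j ≤ N) :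
    PiecewiseContinuous m (f j) := by
  rcases hj.eq_or_lt with rfl | h
  · exact hf.piecewise
  · exact (hf.continuous j h).piecewiseContinuous m

lemma mono (hf : PeriodicDerivChain m N f) {M : ℕ} (h : M ≤ N) : PeriodicDerivChain m M f :=
  ⟨hf.periodic, fun j hj => hf.continuous j (by omega), hf.piecewise_of_le h,
    fun j hj => hf.hasDerivAt j (by omega), fun j hj => hf.hasDerivAt_off_knots j (by omega)⟩

lemma sub (hf : PeriodicDerivChain m N f) (hg : PeriodicDerivChain m N g) :
    PeriodicDerivChain m N fun j t => f j t - g j t :=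
  ⟨fun j t => by simp only [hf.periodic j t, hg.periodic j t],
    fun j hj => (hf.continuous j hj).sub (hg.continuous j hj), hf.piecewise.sub hg.piecewise,
    fun j hj x => (hf.hasDerivAt j hj x).sub (hg.hasDerivAt j hj x),
    fun j hj x hx => (hf.hasDerivAt_off_knots j hj x hx).sub (hg.hasDerivAt_off_knots j hj x hx)⟩

lemma integral_mul_eq_neg (hm : 0 < m) {M : ℕ} (hf : PeriodicDerivChain m N f)
    (hg : PeriodicDerivChain m M g) {a b : ℕ} (ha : a < N) (hb : b < M) :
    ∫ t in (0 : ℝ)..1, f (a + 1) t * g b t = -∫ t in (0 : ℝ)..1, f a t * g (b + 1) t :=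
  integral_deriv_mul_eq_neg hm (hf.continuous a ha) (hg.continuous b hb) (hf.periodic a)
    (hg.periodic b) (hf.piecewise_of_le ha) (hg.piecewise_of_le hb)
    (hf.hasDerivAt_off_knots a ha) (hg.hasDerivAt_off_knots b hb)

lemma integral_mul_iterate (hm : 0 < m) {M : ℕ} (hf : PeriodicDerivChain m N f)
    (hg : PeriodicDerivChain m M g) {a b : ℕ} (ha : a ≤ N) (j : ℕ) (hj : j ≤ a)
    (hb : b + j ≤ M) :
    ∫ t in (0 : ℝ)..1, f a t * g b t =
      (-1) ^ j * ∫ t in (0 : ℝ)..1, f (a - j) t * g (b + j) t := by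
  induction j with
  | zero => simp
  | succ j ih =>
    rw [ih (by omega) (by omega)]
    have := hf.integral_mul_eq_neg hm hg (a := a - (j + 1)) (b := b + j) (by omega) (by omega)
    rw [show a - (j + 1) + 1 = a - j by omega] at this
    rw [this, pow_succ, add_assoc]
    ring

/-- Between the zeros of a function at the knots there are zeros of its derivatives. -/
lemma exists_zeros (hm : 0 < m) (hf : PeriodicDerivChain m N f) (h0 : ∀ i, f 0 (knot m i) = 0)
    (j : ℕ) (hj : j < N) : ∃ z : ℤ → ℝ, (∀ i, z i < z (i + 1)) ∧
      ∀ i, f j (z i) = 0 ∧ knot m i ≤ z i ∧ z i ≤ knot m (i + j) := by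
  induction j with
  | zero => exact ⟨knot m, knot_lt_knot_succ hm, fun i => ⟨h0 i, le_rfl, by simp⟩⟩
  | succ j ih =>
    obtain ⟨z, hz1, hz2⟩ := ih (by omega)
    -- Rolle needs nondegenerate intervals, hence the strict order of z in the induction. Each
    -- derivative widens the window containing z i by one mesh width.
    have h : ∀ i, ∃ c ∈ Set.Ioo (z i) (z (i + 1)), f (j + 1) c = 0 := fun i =>
      exists_hasDerivAt_eq_zero (hz1 i) (hf.continuous j (by omega)).continuousOn
        (by rw [(hz2 i).1, (hz2 (i + 1)).1]) fun x _ => hf.hasDerivAt j hj x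
    choose w hw1 hw2 using h
    refine ⟨w, fun i => (hw1 i).2.trans (hw1 (i + 1)).1, fun i => ⟨hw2 i, ?_, ?_⟩⟩
    · exact (hz2 i).2.1.trans (hw1 i).1.le
    · refine (hw1 i).2.le.trans ((hz2 (i + 1)).2.2.trans (le_of_eq ?_))
      congr 1
      push_cast
      ring

/-- A Poincaré inequality for derivatives of a function that vanishes at the knots. -/
lemma integral_sq_le (hm : 0 < m) (hf : PeriodicDerivChain m N f)
    (h0 : ∀ i, f 0 (knot m i) = 0) {j p : ℕ} (hj : j < N) (hjp : j ≤ p) (hp : 0 < p) :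
    ∫ t in (0 : ℝ)..1, f j t ^ 2 ≤ ((p : ℝ) / m) ^ 2 * ∫ t in (0 : ℝ)..1, f (j + 1) t ^ 2 := by
  have hm' : (0 : ℝ) < m := by exact_mod_cast hm
  obtain ⟨z, -, hz⟩ := hf.exists_zeros hm h0 j hj
  have hpc : PiecewiseContinuous m (f (j + 1)) := hf.piecewise_of_le hj
  have hc := hf.continuous j hj
  -- Integrating from the zero z i gives a pointwise bound: Cauchy–Schwarz on a window of p mesh
  -- widths contributes p/m, and the length of the knot interval another 1/m.
  have hloc : ∀ i : ℤ, ∫ t in knot m i..knot m (i + 1), f j t ^ 2 ≤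
      (p : ℝ) / m ^ 2 * ∫ t in knot m i..knot m (i + p), f (j + 1) t ^ 2 := by
    intro i
    have hle : knot m i ≤ knot m (i + 1) := (knot_lt_knot_succ hm i).le
    have hpt : ∀ x ∈ Set.Icc (knot m i) (knot m (i + 1)), f j x ^ 2 ≤
        (p : ℝ) / m * ∫ t in knot m i..knot m (i + p), f (j + 1) t ^ 2 := by
      intro x hx
      have hx' : x ∈ Set.Icc (knot m i) (knot m (i + p)) :=
        ⟨hx.1, hx.2.trans (knot_mono (by omega))⟩
      have hz' : z i ∈ Set.Icc (knot m i) (knot m (i + p)) :=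
        ⟨(hz i).2.1, (hz i).2.2.trans (knot_mono (by omega))⟩
      have h1 := sq_intervalIntegral_le_of_mem hx' hz' (hpc.intervalIntegrable_knot i p)
        (hpc.sq.intervalIntegrable_knot i p)
      have h2 := integral_eq_of_hasDerivAt_off_countable (a := z i) (b := x) (f j) (f (j + 1))
        (countable_range_knot m) hc.continuousOn
        (fun y hy => hf.hasDerivAt_off_knots j hj y hy.2)
        ((hpc.intervalIntegrable_knot i p).mono_set (by
          rw [Set.uIcc_of_le (hx'.1.trans hx'.2)]
          exact Set.uIcc_subset_Icc hz' hx'))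
      rw [h2, (hz i).1, sub_zero, knot_add_sub] at h1
      exact h1
    have h3 := intervalIntegral.integral_mono_on hle
      ((hc.pow 2).intervalIntegrable (μ := volume) _ _) intervalIntegrable_const hpt
    refine h3.trans (le_of_eq ?_)
    have := knot_add_sub (m := m) i 1
    rw [Nat.cast_one] at this
    rw [intervalIntegral.integral_const, this, smul_eq_mul]
    push_cast
    field_simp
  have hsq : PiecewiseContinuous m fun t => f j t ^ 2 := (hc.piecewiseContinuous m).sq
  have hper : ∀ j, Function.Periodic (fun t => f j t ^ 2) 1 := fun j t => by
    simp only [hf.periodic j t]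
  rw [← hsq.sum_integral_period (hper j) hm 0]
  -- The windows overlap: over a period each knot interval is counted p times, which supplies the
  -- second factor p.
  calc _ ≤ ∑ i ∈ Finset.range m, (p : ℝ) / m ^ 2 *
        ∫ t in knot m ((0 : ℤ) + (i : ℕ))..knot m ((0 : ℤ) + (i : ℕ) + p), f (j + 1) t ^ 2 :=
        Finset.sum_le_sum fun i _ => hloc _
    _ = (p : ℝ) / m ^ 2 * ∑ l ∈ Finset.range p, ∑ i ∈ Finset.range m,
          ∫ t in knot m ((l : ℤ) + (i : ℕ))..knot m ((l : ℤ) + (i : ℕ) + 1), f (j + 1) t ^ 2 := by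
        rw [← Finset.mul_sum, Finset.sum_comm]
        congr 1
        refine Finset.sum_congr rfl fun i _ => ?_
        rw [← hpc.sq.sum_integral]
        refine Finset.sum_congr rfl fun l _ => ?_
        rw [show (0 : ℤ) + (i : ℕ) + (l : ℕ) = (l : ℕ) + (i : ℕ) by ring]
    _ = _ := by
        simp only [hpc.sq.sum_integral_period (hper (j + 1)) hm]
        rw [Finset.sum_const, Finset.card_range, nsmul_eq_mul]
        field_simp

lemma integral_sq_le_pow (hm : 0 < m) (hf : PeriodicDerivChain m N f)
    (h0 : ∀ i, f 0 (knot m i) = 0) {p : ℕ} (hp : 0 < p) (j : ℕ) (hj : j ≤ N) (hjp : j ≤ p) :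
    ∫ t in (0 : ℝ)..1, f 0 t ^ 2 ≤ ((p : ℝ) / m) ^ (2 * j) * ∫ t in (0 : ℝ)..1, f j t ^ 2 := by
  induction j with
  | zero => simp
  | succ j ih =>
    refine (ih (by omega) (by omega)).trans ?_
    rw [mul_add, pow_add, mul_assoc]
    gcongr
    simpa using hf.integral_sq_le hm h0 (by omega : j < N) (by omega : j ≤ p) hp

/-- The error of odd degree spline interpolation, by the energy method. -/
lemma integral_sq_sub_le (hm : 0 < m) {q : ℕ} {u v : ℕ → ℝ → ℝ}
    (hu : PeriodicDerivChain m (2 * q + 2) u) (hv : PeriodicDerivChain m (2 * q + 1) v)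
    (hconst : ∀ i : ℤ, ∃ c : ℝ, ∀ t ∈ Set.Ioo (knot m i) (knot m (i + 1)), v (2 * q + 1) t = c)
    (h0 : ∀ i, u 0 (knot m i) = v 0 (knot m i)) :
    ∫ t in (0 : ℝ)..1, (u 0 t - v 0 t) ^ 2 ≤
      (((q + 1 : ℕ) : ℝ) / m) ^ (4 * (q + 1)) * ∫ t in (0 : ℝ)..1, u (2 * q + 2) t ^ 2 := by
  set e : ℕ → ℝ → ℝ := fun j t => u j t - v j t with he
  have hE : PeriodicDerivChain m (2 * q + 1) e := (hu.mono (by omega)).sub hv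
  have he0 : ∀ i, e 0 (knot m i) = 0 := fun i => by simp [he, h0 i]
  have h1 := hE.integral_sq_le_pow hm he0 (p := q + 1) (by omega) (q + 1) (by omega) le_rfl
  -- Orthogonality: q integrations by parts lead to the product of e 1 and v (2q+1). The latter is
  -- constant on each knot interval, where e 1 integrates to a difference of values of e 0 at knots,
  -- which is 0.
  have h2 : ∫ t in (0 : ℝ)..1, e (q + 1) t * v (q + 1) t = 0 := by
    rw [hE.integral_mul_iterate hm hv (by omega) q (by omega) (by omega),
      show q + 1 - q = 1 by omega, show q + 1 + q = 2 * q + 1 by ring]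
    have hpc := (hE.piecewise_of_le (j := 1) (by omega)).mul hv.piecewise
    rw [← hpc.sum_integral_period (fun t => by
      simp only [hE.periodic 1 t, hv.periodic (2 * q + 1) t]) hm 0, Finset.sum_eq_zero, mul_zero]
    intro l _
    obtain ⟨c, hc⟩ := hconst (0 + l)
    have hle := (knot_lt_knot_succ hm (0 + (l : ℤ))).le
    have h3 : ∫ t in knot m (0 + l)..knot m (0 + l + 1), e 1 t * v (2 * q + 1) t =
        ∫ t in knot m (0 + l)..knot m (0 + l + 1), e 1 t * c := by
      rw [intervalIntegral.integral_of_le hle, intervalIntegral.integral_of_le hle,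
        integral_Ioc_eq_integral_Ioo, integral_Ioc_eq_integral_Ioo]
      exact setIntegral_congr_fun measurableSet_Ioo fun t ht => by
        rw [hc t ht]
    rw [h3, intervalIntegral.integral_mul_const,
      integral_eq_of_hasDerivAt_off_countable (e 0) (e 1) (countable_range_knot m)
        (hE.continuous 0 (by omega)).continuousOn
        (fun x hx => hE.hasDerivAt_off_knots 0 (by omega) x hx.2)
        ((hE.piecewise_of_le (by omega)).intervalIntegrable_knot_succ _), he0, he0]
    simp
  have h3 : ∫ t in (0 : ℝ)..1, e (q + 1) t * u (q + 1) t =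
      (-1) ^ (q + 1) * ∫ t in (0 : ℝ)..1, e 0 t * u (2 * q + 2) t := by
    rw [hE.integral_mul_iterate hm hu (by omega) (q + 1) le_rfl (by omega), Nat.sub_self,
      show q + 1 + (q + 1) = 2 * q + 2 by ring]
  have hEp := hE.piecewise_of_le (j := q + 1) (by omega)
  have h4 : ∫ t in (0 : ℝ)..1, e (q + 1) t ^ 2 =
      (-1) ^ (q + 1) * ∫ t in (0 : ℝ)..1, e 0 t * u (2 * q + 2) t := by
    have h5 : (∫ t in (0 : ℝ)..1, e (q + 1) t * u (q + 1) t) -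
        ∫ t in (0 : ℝ)..1, e (q + 1) t * v (q + 1) t = ∫ t in (0 : ℝ)..1, e (q + 1) t ^ 2 := by
      rw [← intervalIntegral.integral_sub]
      · congr 1
        ext t
        simp only [he]
        ring
      · exact (hEp.mul (hu.piecewise_of_le (by omega))).intervalIntegrable_unit hm
      · exact (hEp.mul (hv.piecewise_of_le (by omega))).intervalIntegrable_unit hm
    rw [← h3, ← h5, h2, sub_zero]
  have hE0 := hE.piecewise_of_le (j := 0) (by omega)
  have hU := hu.piecewise
  set A := ∫ t in (0 : ℝ)..1, e 0 t ^ 2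
  set B := ∫ t in (0 : ℝ)..1, u (2 * q + 2) t ^ 2
  set F := ∫ t in (0 : ℝ)..1, e (q + 1) t ^ 2
  set I := ∫ t in (0 : ℝ)..1, e 0 t * u (2 * q + 2) t
  -- Cauchy–Schwarz through the discriminant of the nonnegative quadratic x ↦ ∫ (x e + u^(2q+2))².
  have hcs : I ^ 2 ≤ A * B := by
    have hquad : ∀ x : ℝ, 0 ≤ A * (x * x) + (2 * I) * x + B := by
      intro x
      have h5 : 0 ≤ ∫ t in (0 : ℝ)..1, (e 0 t * x + u (2 * q + 2) t) ^ 2 :=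
        intervalIntegral.integral_nonneg zero_le_one fun t _ => sq_nonneg _
      have h6 : ∀ t, (e 0 t * x + u (2 * q + 2) t) ^ 2 =
          (e 0 t ^ 2 * (x * x) + e 0 t * u (2 * q + 2) t * (2 * x)) + u (2 * q + 2) t ^ 2 :=
        fun t => by ring
      simp only [h6] at h5
      have i1 := (hE0.sq.intervalIntegrable_unit hm).mul_const (x * x)
      have i2 := ((hE0.mul hU).intervalIntegrable_unit hm).mul_const (2 * x)
      rw [intervalIntegral.integral_add (i1.add i2) (hU.sq.intervalIntegrable_unit hm),
        intervalIntegral.integral_add i1 i2, intervalIntegral.integral_mul_const,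
        intervalIntegral.integral_mul_const] at h5
      linarith
    have := discrim_le_zero hquad
    rw [discrim] at this
    linarith
  have hF2 : F ^ 2 ≤ A * B := by
    rw [h4, mul_pow, ← pow_mul, mul_comm (q + 1) 2, pow_mul]
    simpa using hcs
  have hA0 : 0 ≤ A := intervalIntegral.integral_nonneg zero_le_one fun t _ => sq_nonneg _
  have hB0 : 0 ≤ B := intervalIntegral.integral_nonneg zero_le_one fun t _ => sq_nonneg _
  set K := (((q + 1 : ℕ) : ℝ) / m) ^ (2 * (q + 1)) with hK
  have hKK : (((q + 1 : ℕ) : ℝ) / m) ^ (4 * (q + 1)) = K ^ 2 := by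
    rw [hK, ← pow_mul]
    congr 1
    ring
  rw [hKK]
  change A ≤ _
  -- A ≤ K F and F² ≤ A B give A² ≤ K² A B; one factor A is cancelled when it is nonzero.
  rcases hA0.eq_or_lt with h | h
  · rw [← h]; positivity
  · have h7 : A ^ 2 ≤ K ^ 2 * (A * B) := by
      calc A ^ 2 ≤ (K * F) ^ 2 := pow_le_pow_left₀ hA0 h1 2
        _ = K ^ 2 * F ^ 2 := by ring
        _ ≤ _ := by gcongr
    have h8 : A * A ≤ A * (K ^ 2 * B) := by linarith
    exact le_of_mul_le_mul_left h8 h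

end PeriodicDerivChain

/-! ### Existence, uniqueness and error of the spline interpolant -/

lemma Function.Periodic.iteratedDeriv {f : ℝ → ℝ} {c : ℝ} (hf : Function.Periodic f c) (n : ℕ) :
    Function.Periodic (iteratedDeriv n f) c := by
  intro x
  have h1 := congrFun (iteratedDeriv_comp_add_const n f c) x
  rw [show (fun z => f (z + c)) = f from funext hf] at h1
  exact h1.symm

lemma PeriodicDerivChain.of_contDiff (m : ℕ) {N : ℕ} {u : ℝ → ℝ} (hp : Function.Periodic u 1)
    (hu : ContDiff ℝ (N : WithTop ℕ∞) u) :
    PeriodicDerivChain m N fun j => iteratedDeriv j u := by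
  have hd : ∀ j < N, ∀ x, HasDerivAt (iteratedDeriv j u) (iteratedDeriv (j + 1) u x) x := by
    intro j hj x
    rw [iteratedDeriv_succ]
    exact (hu.differentiable_iteratedDeriv j (by exact_mod_cast hj) x).hasDerivAt
  exact ⟨hp.iteratedDeriv, fun j hj => hu.continuous_iteratedDeriv j (by exact_mod_cast hj.le),
    (hu.continuous_iteratedDeriv N le_rfl).piecewiseContinuous m,
    fun j hj => hd j (by omega), fun j hj x _ => hd j hj x⟩

lemma iteratedDeriv_eq_eval {f : ℝ → ℝ} {q : Polynomial ℝ} {s : Set ℝ} (hs : IsOpen s)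
    (h : ∀ t ∈ s, f t = q.eval t) (j : ℕ) :
    ∀ t ∈ s, iteratedDeriv j f t = (Polynomial.derivative^[j] q).eval t := by
  induction j with
  | zero => simpa using h
  | succ j ih =>
    intro t ht
    rw [iteratedDeriv_succ, Function.iterate_succ_apply', ← Polynomial.deriv]
    exact Filter.EventuallyEq.deriv_eq (Filter.eventuallyEq_of_mem (hs.mem_nhds ht) ih)

lemma exists_mem_Ioo_knot {m : ℕ} (hm : 0 < m) {x : ℝ} (hx : x ∉ Set.range (knot m)) :
    ∃ i : ℤ, x ∈ Set.Ioo (knot m i) (knot m (i + 1)) := by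
  have hm' : (m : ℝ) ≠ 0 := by exact_mod_cast hm.ne'
  refine ⟨⌊m * x⌋, (mem_Ioo_knot_iff hm _ _).2 ⟨lt_of_le_of_ne (Int.floor_le _) fun h => hx ?_,
    Int.lt_floor_add_one _⟩⟩
  exact ⟨⌊m * x⌋, by rw [knot, h]; field_simp⟩

namespace IsPeriodicSpline

variable {k m : ℕ} {p p₁ p₂ : ℝ → ℝ}

/-- The derivative of order k is controlled only off the knots; at a knot `iteratedDeriv k p` may be
the default value of `deriv`, which no integral sees. -/
lemma periodicDerivChain (hm : 0 < m) (hk : 0 < k) (h : IsPeriodicSpline k m p) :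
    PeriodicDerivChain m k fun j => iteratedDeriv j p := by
  obtain ⟨hper, hc, hq⟩ := h
  refine ⟨hper.iteratedDeriv, fun j hj => hc.continuous_iteratedDeriv j ?_, fun i => ?_,
    fun j hj x => ?_, fun j hj x hx => ?_⟩
  · exact_mod_cast (by omega : j ≤ k - 1)
  · obtain ⟨q, -, hq⟩ := hq i
    exact ⟨fun t => (Polynomial.derivative^[k] q).eval t, Polynomial.continuous _,
      iteratedDeriv_eq_eval isOpen_Ioo hq k⟩
  · rw [iteratedDeriv_succ]
    exact (hc.differentiable_iteratedDeriv j
      (by exact_mod_cast (by omega : j < k - 1)) x).hasDerivAt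
  · obtain ⟨i, hi⟩ := exists_mem_Ioo_knot hm hx
    obtain ⟨q, -, hq⟩ := hq i
    rw [iteratedDeriv_succ]
    refine DifferentiableAt.hasDerivAt ?_
    exact (Polynomial.differentiable _ x).congr_of_eventuallyEq
      (Filter.eventuallyEq_of_mem (isOpen_Ioo.mem_nhds hi) (iteratedDeriv_eq_eval isOpen_Ioo hq j))

lemma exists_iteratedDeriv_eq_const (h : IsPeriodicSpline k m p) (i : ℤ) :
    ∃ c : ℝ, ∀ t ∈ Set.Ioo (knot m i) (knot m (i + 1)), iteratedDeriv k p t = c := by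
  obtain ⟨q, hqd, hq⟩ := h.2.2 i
  have h1 := Polynomial.natDegree_iterate_derivative q k
  rw [Nat.sub_eq_zero_of_le hqd] at h1
  refine ⟨(Polynomial.derivative^[k] q).coeff 0, fun t ht => ?_⟩
  rw [iteratedDeriv_eq_eval isOpen_Ioo hq k t ht, Polynomial.eq_C_of_natDegree_le_zero h1]
  simp

lemma eq_zero_of_integral_sq_le_zero {f : ℝ → ℝ} (hf : Continuous f)
    (h : ∫ t in (0 : ℝ)..1, f t ^ 2 ≤ 0) : ∀ t ∈ Set.Icc (0 : ℝ) 1, f t = 0 := by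
  intro t ht
  by_contra hne
  refine not_lt_of_ge h (intervalIntegral.integral_pos zero_lt_one (by fun_prop)
    (fun y _ => sq_nonneg _) ⟨t, ht, by positivity⟩)

lemma eq_of_eqOn_unit (h₁ : IsPeriodicSpline k m p₁) (h₂ : IsPeriodicSpline k m p₂)
    (h : ∀ t ∈ Set.Icc (0 : ℝ) 1, p₁ t = p₂ t) : p₁ = p₂ := by
  ext t
  have hper : Function.Periodic (fun t => p₁ t - p₂ t) 1 := fun t => by
    simp only [h₁.1 t, h₂.1 t]
  obtain ⟨y, hy, hty⟩ := hper.exists_mem_Ico₀ zero_lt_one t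
  rw [← sub_eq_zero]
  refine hty.trans ?_
  rw [h y (Set.Ico_subset_Icc_self hy), sub_self]

/-- The energy estimate for u = 0 and v = p₁ - p₂ has right-hand side 0. -/
lemma eq_of_eq_knot (hm : 0 < m) (hk : Odd k) (h₁ : IsPeriodicSpline k m p₁)
    (h₂ : IsPeriodicSpline k m p₂) (h : ∀ i, p₁ (knot m i) = p₂ (knot m i)) : p₁ = p₂ := by
  obtain ⟨q, rfl⟩ := hk
  have hv := (h₁.periodicDerivChain hm (by omega)).sub (h₂.periodicDerivChain hm (by omega))
  have hu : PeriodicDerivChain m (2 * q + 2) fun _ _ => (0 : ℝ) :=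
    ⟨fun _ _ => rfl, fun _ _ => continuous_const, continuous_const.piecewiseContinuous m,
      fun _ _ x => hasDerivAt_const x 0, fun _ _ x _ => hasDerivAt_const x 0⟩
  have h3 := PeriodicDerivChain.integral_sq_sub_le hm hu hv (fun i => by
    obtain ⟨c₁, hc₁⟩ := h₁.exists_iteratedDeriv_eq_const i
    obtain ⟨c₂, hc₂⟩ := h₂.exists_iteratedDeriv_eq_const i
    exact ⟨c₁ - c₂, fun t ht => by rw [hc₁ t ht, hc₂ t ht]⟩) (fun i => by simp [h i])
  simp only [iteratedDeriv_zero, zero_sub, neg_sq] at h3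
  have hc : Continuous fun t => p₁ t - p₂ t := h₁.2.1.continuous.sub h₂.2.1.continuous
  refine h₁.eq_of_eqOn_unit h₂ fun t ht => sub_eq_zero.1 ?_
  exact eq_zero_of_integral_sq_le_zero hc (by simpa using h3) t ht

end IsPeriodicSpline

lemma eq_knot_of_forall_fin {m : ℕ} (hm : 0 < m) {f g : ℝ → ℝ} (hf : Function.Periodic f 1)
    (hg : Function.Periodic g 1) (h : ∀ i : Fin m, f (knot m (i : ℕ)) = g (knot m (i : ℕ))) (i : ℤ) :
    f (knot m i) = g (knot m i) := by
  have hm' : (m : ℝ) ≠ 0 := by exact_mod_cast hm.ne'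
  obtain ⟨s, j, hj⟩ : ∃ s : Fin m, ∃ j : ℤ, (s : ℤ) + j * m = i :=
    ⟨_, (finMod_eq_iff hm i (finMod hm i)).1 rfl⟩
  have e : knot m i = knot m (s : ℕ) + j * 1 := by
    rw [knot, ← hj, knot]
    push_cast
    field_simp
  rw [e, hf.int_mul j, hg.int_mul j]
  exact h _

lemma IsSplineInterpolant.eq_knot {k m : ℕ} (hm : 0 < m) {u p : ℝ → ℝ}
    (hu : Function.Periodic u 1) (hp : IsSplineInterpolant k m u p) (i : ℤ) :
    p (knot m i) = u (knot m i) :=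
  eq_knot_of_forall_fin hm hp.1.1 hu (fun i => by simpa using hp.2 i i.2.le) i

lemma IsSplineInterpolant.unique {k m : ℕ} (hm : 0 < m) (hk : Odd k) {u p₁ p₂ : ℝ → ℝ}
    (hu : Function.Periodic u 1) (h₁ : IsSplineInterpolant k m u p₁)
    (h₂ : IsSplineInterpolant k m u p₂) : p₁ = p₂ :=
  h₁.1.eq_of_eq_knot hm hk h₂.1 fun i => by rw [h₁.eq_knot hm hu, h₂.eq_knot hm hu]

/-- The `L²` error of spline interpolation of odd degree. -/
lemma IsSplineInterpolant.integral_sq_sub_le {q m : ℕ} (hm : 0 < m) {u p : ℝ → ℝ}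
    (hu : Function.Periodic u 1) (hu' : ContDiff ℝ ((2 * q + 2 : ℕ) : WithTop ℕ∞) u)
    (hp : IsSplineInterpolant (2 * q + 1) m u p) :
    ∫ t in (0 : ℝ)..1, (u t - p t) ^ 2 ≤ (((q + 1 : ℕ) : ℝ) / m) ^ (4 * (q + 1)) *
      ∫ t in (0 : ℝ)..1, iteratedDeriv (2 * q + 2) u t ^ 2 := by
  have := PeriodicDerivChain.integral_sq_sub_le hm (PeriodicDerivChain.of_contDiff m hu hu')
    (hp.1.periodicDerivChain hm (by omega)) hp.1.exists_iteratedDeriv_eq_const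
    (fun i => by simp [hp.eq_knot hm hu i])
  simpa using this

lemma eq_zero_of_splineSum_eq_zero {k m : ℕ} (hm : 0 < m) (hk : 0 < k) {θ : Fin m → ℝ}
    (h : ∀ t ∈ Set.Icc (0 : ℝ) 1, splineSum k m θ t = 0) : θ = 0 := by
  obtain ⟨c, hc, hG⟩ := exists_le_integral_sq_splineSum hk
  have h1 := hG m hm θ
  have h2 : ∫ t in (0 : ℝ)..1, splineSum k m θ t ^ 2 = 0 := by
    rw [intervalIntegral.integral_congr (g := fun _ => (0 : ℝ)) fun t ht => by
      rw [Set.uIcc_of_le zero_le_one] at ht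
      simp [h t ht]]
    simp
  have hcm : 0 < c / m := div_pos hc (by exact_mod_cast hm)
  rw [h2] at h1
  have h3 : ∑ s, θ s ^ 2 ≤ 0 := nonpos_of_mul_nonpos_right h1 hcm
  ext s
  have h4 := (Finset.sum_eq_zero_iff_of_nonneg fun s _ => sq_nonneg (θ s)).1
    (le_antisymm h3 (Finset.sum_nonneg fun s _ => sq_nonneg (θ s))) s (Finset.mem_univ s)
  simpa using h4

lemma splineSum_sub (k m : ℕ) (θ θ' : Fin m → ℝ) (t : ℝ) :
    splineSum k m (θ - θ') t = splineSum k m θ t - splineSum k m θ' t := by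
  simp [splineSum, mul_sub, Finset.sum_sub_distrib]

/-- Interpolation is a square linear system in the m coefficients. It is injective by uniqueness of
interpolating splines and independence of the basis, hence surjective. -/
lemma exists_isSplineInterpolant_splineSum {k m : ℕ} (hm : 0 < m) (hk : Odd k) {u : ℝ → ℝ}
    (hu : Function.Periodic u 1) : ∃ θ, IsSplineInterpolant k m u (splineSum k m θ) := by
  have hspl := isPeriodicSpline_splineSum hm hk.pos
  let L : (Fin m → ℝ) →ₗ[ℝ] (Fin m → ℝ) :=
    { toFun := fun θ i => splineSum k m θ (knot m (i : ℕ))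
      map_add' := fun θ θ' => by
        ext i
        simp [splineSum, mul_add, Finset.sum_add_distrib]
      map_smul' := fun c θ => by
        ext i
        simp only [splineSum, Pi.smul_apply, smul_eq_mul, RingHom.id_apply, Finset.mul_sum]
        exact Finset.sum_congr rfl fun s _ => by ring }
  have hzero : splineSum k m 0 = fun _ => 0 := by
    ext t
    simp [splineSum]
  have hinj : Function.Injective L := by
    rw [← LinearMap.ker_eq_bot, LinearMap.ker_eq_bot']
    intro θ hθ
    have h1 : splineSum k m θ = splineSum k m 0 :=
      (hspl θ).eq_of_eq_knot hm hk (hspl 0) fun i =>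
        eq_knot_of_forall_fin hm (hspl θ).1 (hspl 0).1 (fun i => by
          rw [hzero]
          exact congrFun hθ i) i
    exact eq_zero_of_splineSum_eq_zero hm hk.pos fun t _ => by rw [h1, hzero]
  obtain ⟨θ, hθ⟩ := LinearMap.injective_iff_surjective.1 hinj fun i => u (knot m (i : ℕ))
  refine ⟨θ, hspl θ, fun i _ => ?_⟩
  exact eq_knot_of_forall_fin hm (hspl θ).1 hu (fun i => congrFun hθ i) i

lemma existsUnique_isSplineInterpolant {k m : ℕ} (hm : 0 < m) (hk : Odd k) {u : ℝ → ℝ}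
    (hu : Function.Periodic u 1) : ∃! p, IsSplineInterpolant k m u p := by
  obtain ⟨θ, hθ⟩ := exists_isSplineInterpolant_splineSum hm hk hu
  exact ⟨_, hθ, fun p hp => hp.unique hm hk hu hθ⟩

lemma isInterpolantCoeff_iff {k m : ℕ} (hm : 0 < m) (hk : Odd k) {u : ℝ → ℝ}
    (hu : Function.Periodic u 1) {θ' : EuclideanSpace ℝ (Fin m)}
    (hθ' : IsSplineInterpolant k m u (splineSum k m θ')) (θ : EuclideanSpace ℝ (Fin m)) :
    IsInterpolantCoeff k m u θ ↔ θ = θ' := by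
  constructor
  · rintro ⟨p, hp, hpθ⟩
    have h1 := hp.unique hm hk hu hθ'
    have h2 : (θ : Fin m → ℝ) - (θ' : Fin m → ℝ) = 0 :=
      eq_zero_of_splineSum_eq_zero hm hk.pos fun t ht => by
        rw [splineSum_sub, sub_eq_zero, ← h1, hpθ t ht, splineSum]
    ext s
    simpa [sub_eq_zero] using congrFun h2 s
  · rintro rfl
    exact ⟨_, hθ', fun t _ => rfl⟩

/-! ### Linear algebra of least squares, given a lower bound `lam` for NᵀN -/

section LeastSquares

variable {m n : ℕ} {N : Matrix (Fin n) (Fin m) ℝ} {lam : ℝ}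

lemma dotProduct_self_eq_sum_sq {ι : Type*} [Fintype ι] (v : ι → ℝ) : v ⬝ᵥ v = ∑ i, v i ^ 2 := by
  simp [dotProduct, sq]

lemma dotProduct_transpose_mulVec_eq (θ : Fin m → ℝ) (w : Fin n → ℝ) :
    θ ⬝ᵥ (Nᵀ *ᵥ w) = (N *ᵥ θ) ⬝ᵥ w := by
  rw [Matrix.dotProduct_mulVec, Matrix.vecMul_transpose]

lemma isUnit_transpose_mul_self (hlam : 0 < lam)
    (hN : ∀ θ : Fin m → ℝ, lam * ∑ s, θ s ^ 2 ≤ ∑ i, (N *ᵥ θ) i ^ 2) : IsUnit (Nᵀ * N) := by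
  rw [← Matrix.mulVec_injective_iff_isUnit]
  refine (injective_iff_map_eq_zero (Matrix.mulVecLin (Nᵀ * N))).2 fun θ hθ => ?_
  rw [Matrix.mulVecLin_apply] at hθ
  have h1 : (N *ᵥ θ) ⬝ᵥ (N *ᵥ θ) = 0 := by
    rw [← dotProduct_transpose_mulVec_eq, Matrix.mulVec_mulVec, hθ, dotProduct_zero]
  have h2 := hN θ
  rw [← dotProduct_self_eq_sum_sq, ← dotProduct_self_eq_sum_sq, h1] at h2
  have h3 : θ ⬝ᵥ θ ≤ 0 := nonpos_of_mul_nonpos_right h2 hlam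
  have h4 : 0 ≤ θ ⬝ᵥ θ := by
    rw [dotProduct_self_eq_sum_sq]
    exact Finset.sum_nonneg fun s _ => sq_nonneg _
  exact dotProduct_self_eq_zero.1 (le_antisymm h3 h4)

/-- For the least-squares solution d, the vector N d is the orthogonal projection of w onto the
column space, so lam |d|² ≤ |N d|² ≤ |w|². -/
lemma sum_sq_leastSquares_le (hlam : 0 < lam)
    (hN : ∀ θ : Fin m → ℝ, lam * ∑ s, θ s ^ 2 ≤ ∑ i, (N *ᵥ θ) i ^ 2) (w : Fin n → ℝ) :
    lam * ∑ s, (((Nᵀ * N)⁻¹ * Nᵀ) *ᵥ w) s ^ 2 ≤ ∑ i, w i ^ 2 := by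
  have hM := (Matrix.isUnit_iff_isUnit_det _).1 (isUnit_transpose_mul_self hlam hN)
  set d := ((Nᵀ * N)⁻¹ * Nᵀ) *ᵥ w with hd
  have h1 : (Nᵀ * N) *ᵥ d = Nᵀ *ᵥ w := by
    rw [hd, Matrix.mulVec_mulVec, Matrix.mul_nonsing_inv_cancel_left _ _ hM]
  have h2 : (N *ᵥ d) ⬝ᵥ (N *ᵥ d) = (N *ᵥ d) ⬝ᵥ w := by
    rw [← dotProduct_transpose_mulVec_eq, Matrix.mulVec_mulVec, h1, dotProduct_transpose_mulVec_eq]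
  refine (hN d).trans ?_
  have h3 : 0 ≤ (w - N *ᵥ d) ⬝ᵥ (w - N *ᵥ d) := by
    rw [dotProduct_self_eq_sum_sq]
    exact Finset.sum_nonneg fun s _ => sq_nonneg _
  rw [sub_dotProduct, dotProduct_sub, dotProduct_sub, h2, dotProduct_comm w (N *ᵥ d)] at h3
  rw [← dotProduct_self_eq_sum_sq, ← dotProduct_self_eq_sum_sq, h2]
  linarith

/-- For y = (NᵀN)⁻¹ x one has lam |y|² ≤ |N y|² = ⟨y, x⟩ ≤ |y| |x|. -/
lemma matrixNorm2_smul_inv_le (hlam : 0 < lam)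
    (hN : ∀ θ : Fin m → ℝ, lam * ∑ s, θ s ^ 2 ≤ ∑ i, (N *ᵥ θ) i ^ 2) {c : ℝ} (hc : 0 ≤ c) :
    matrixNorm2 (c • (Nᵀ * N)⁻¹) ≤ c / lam := by
  have hM := (Matrix.isUnit_iff_isUnit_det _).1 (isUnit_transpose_mul_self hlam hN)
  refine ContinuousLinearMap.opNorm_le_bound _ (by positivity) fun x => ?_
  set y : Fin m → ℝ := (Nᵀ * N)⁻¹ *ᵥ x.ofLp with hy
  have h1 : (Nᵀ * N) *ᵥ y = x.ofLp := by
    rw [hy, Matrix.mulVec_mulVec, Matrix.mul_nonsing_inv _ hM, Matrix.one_mulVec]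
  have h2 : ∑ i, (N *ᵥ y) i ^ 2 = ∑ s, y s * x s := by
    rw [← dotProduct_self_eq_sum_sq, ← dotProduct_transpose_mulVec_eq, Matrix.mulVec_mulVec, h1]
    rfl
  have h3 : lam * ‖WithLp.toLp 2 y‖ ^ 2 ≤ ‖WithLp.toLp 2 y‖ * ‖x‖ := by
    have h4 := hN y
    rw [h2] at h4
    have h5 : ∑ s, y s * x s = inner ℝ x (WithLp.toLp 2 y) := by
      simp [PiLp.inner_apply]
    rw [h5] at h4
    rw [EuclideanSpace.norm_sq_eq]
    simp only [Real.norm_eq_abs, sq_abs]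
    refine h4.trans ((real_inner_le_norm _ _).trans_eq (mul_comm _ _))
  have h6 : lam * ‖WithLp.toLp 2 y‖ ≤ ‖x‖ := by
    rcases (norm_nonneg (WithLp.toLp 2 y)).eq_or_lt with h | h
    · rw [← h, mul_zero]; exact norm_nonneg x
    · exact le_of_mul_le_mul_left (by linarith) h
  have h7 : Matrix.toEuclideanCLM (n := Fin m) (𝕜 := ℝ) (c • (Nᵀ * N)⁻¹) x =
      c • WithLp.toLp 2 y := by
    ext s
    simp [hy]
  rw [h7, norm_smul, Real.norm_of_nonneg hc, div_mul_eq_mul_div, mul_div_assoc]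
  gcongr
  rw [le_div_iff₀ hlam, mul_comm]
  exact h6

end LeastSquares

/-! ### Mean and covariance under Gaussian noise -/

section Noise

variable {Ω : Type*} [MeasurableSpace Ω] {Q : Measure Ω} {m n : ℕ}
  {v : ℝ≥0} {η : Fin n → Ω → ℝ}

lemma memLp_of_map_eq_gaussianReal {X : Ω → ℝ} (hX : Measurable X)
    (h : Q.map X = gaussianReal 0 v) : MemLp X 2 Q := by
  have := memLp_id_gaussianReal' (μ := 0) (v := v) 2 (by simp)
  rw [← h, memLp_map_measure_iff (by fun_prop) hX.aemeasurable] at this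
  simpa using this

lemma integral_of_map_eq_gaussianReal {X : Ω → ℝ} (hX : Measurable X)
    (h : Q.map X = gaussianReal 0 v) : ∫ ω, X ω ∂Q = 0 := by
  have := integral_id_gaussianReal (μ := 0) (v := v)
  rwa [← h, integral_map hX.aemeasurable (by fun_prop)] at this

lemma covariance_gaussian_noise (hη : ∀ i, Measurable (η i))
    (hl : ∀ i, Q.map (η i) = gaussianReal 0 v) (hi : iIndepFun η Q) (i j : Fin n) :
    covariance (η i) (η j) Q = if i = j then (v : ℝ) else 0 := by
  split_ifs with h
  · subst h
    rw [covariance_self (hη i).aemeasurable]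
    have := variance_id_gaussianReal (μ := 0) (v := v)
    rw [← hl i, variance_map (by fun_prop) (hη i).aemeasurable] at this
    simpa using this
  · exact (hi.indepFun h).covariance_eq_zero (memLp_of_map_eq_gaussianReal (hη i) (hl i))
      (memLp_of_map_eq_gaussianReal (hη j) (hl j))

lemma mulVec_affine_noise_apply {Ω : Type*} {η : Fin n → Ω → ℝ} (P : Matrix (Fin m) (Fin n) ℝ) (y : Fin n → ℝ) (a : Fin m) :
    (fun ω => (P *ᵥ fun i => y i + η i ω) a) =
      fun ω => (P *ᵥ y) a + ∑ i, P a i * η i ω := by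
  ext ω
  simp [Matrix.mulVec, dotProduct, mul_add, Finset.sum_add_distrib]

lemma memLp_sum_noise (hη : ∀ i, Measurable (η i)) (hl : ∀ i, Q.map (η i) = gaussianReal 0 v)
    (b : Fin n → ℝ) : MemLp (fun ω => ∑ i, b i * η i ω) 2 Q := by
  have h : ∀ i ∈ Finset.univ, MemLp (fun ω => b i * η i ω) 2 Q := fun i _ =>
    (memLp_of_map_eq_gaussianReal (hη i) (hl i)).const_mul (b i)
  exact memLp_finsetSum Finset.univ h

variable [IsProbabilityMeasure Q]

lemma memLp_affine_noise (hη : ∀ i, Measurable (η i)) (hl : ∀ i, Q.map (η i) = gaussianReal 0 v)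
    (P : Matrix (Fin m) (Fin n) ℝ) (y : Fin n → ℝ) :
    MemLp (fun ω => (WithLp.toLp 2 (P *ᵥ fun i => y i + η i ω) : EuclideanSpace ℝ (Fin m)))
      2 Q := by
  have h : ∀ a, MemLp (fun ω => (P *ᵥ fun i => y i + η i ω) a) 2 Q := fun a => by
    rw [mulVec_affine_noise_apply]
    exact MemLp.add (memLp_const ((P *ᵥ y) a)) (memLp_sum_noise hη hl (P a))
  exact MemLp.of_eval_piLp (q := 2) h

lemma integral_affine_noise (hη : ∀ i, Measurable (η i))
    (hl : ∀ i, Q.map (η i) = gaussianReal 0 v) (P : Matrix (Fin m) (Fin n) ℝ) (y : Fin n → ℝ) :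
    ∫ ω, (WithLp.toLp 2 (P *ᵥ fun i => y i + η i ω) : EuclideanSpace ℝ (Fin m)) ∂Q =
      WithLp.toLp 2 (P *ᵥ y) := by
  have hint := (memLp_affine_noise hη hl P y).integrable one_le_two
  ext a
  rw [eval_integral_piLp fun a => hint.eval_piLp a]
  change ∫ ω, (P *ᵥ fun i => y i + η i ω) a ∂Q = (P *ᵥ y) a
  have hi : ∀ i, Integrable (η i) Q := fun i =>
    (memLp_of_map_eq_gaussianReal (hη i) (hl i)).integrable one_le_two
  rw [mulVec_affine_noise_apply, integral_add (integrable_const _)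
    ((memLp_sum_noise hη hl _).integrable one_le_two),
    integral_finsetSum _ fun i _ => (hi i).const_mul _]
  simp [integral_const_mul, integral_of_map_eq_gaussianReal (hη _) (hl _)]

lemma covMatrix_affine_noise (hη : ∀ i, Measurable (η i))
    (hl : ∀ i, Q.map (η i) = gaussianReal 0 v) (hi : iIndepFun η Q)
    (P : Matrix (Fin m) (Fin n) ℝ) (y : Fin n → ℝ) :
    covMatrix Q (fun ω => WithLp.toLp 2 (P *ᵥ fun i => y i + η i ω)) = (v : ℝ) • (P * Pᵀ) := by
  ext a b
  change covariance (fun ω => (P *ᵥ fun i => y i + η i ω) a)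
    (fun ω => (P *ᵥ fun i => y i + η i ω) b) Q = _
  have hm : ∀ a i, MemLp (fun ω => P a i * η i ω) 2 Q := fun a i =>
    (memLp_of_map_eq_gaussianReal (hη i) (hl i)).const_mul _
  rw [mulVec_affine_noise_apply, mulVec_affine_noise_apply,
    covariance_const_add_left ((memLp_sum_noise hη hl _).integrable one_le_two),
    covariance_const_add_right ((memLp_sum_noise hη hl _).integrable one_le_two),
    covariance_fun_sum_fun_sum (hm a) (hm b)]
  simp only [covariance_const_mul_left, covariance_const_mul_right]
  simp only [covariance_gaussian_noise hη hl hi, mul_ite, mul_zero, Finset.sum_ite_eq,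
    Finset.mem_univ, if_true, Matrix.smul_apply, Matrix.mul_apply, Matrix.transpose_apply,
    smul_eq_mul, Finset.mul_sum]
  exact Finset.sum_congr rfl fun i _ => by ring

end Noise

lemma leastSquares_mul_transpose {m n : ℕ} {N : Matrix (Fin n) (Fin m) ℝ}
    (h : IsUnit (Nᵀ * N)) :
    ((Nᵀ * N)⁻¹ * Nᵀ) * ((Nᵀ * N)⁻¹ * Nᵀ)ᵀ = (Nᵀ * N)⁻¹ := by
  have hM := (Matrix.isUnit_iff_isUnit_det _).1 h
  rw [Matrix.transpose_mul, Matrix.transpose_transpose, Matrix.transpose_nonsing_inv,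
    Matrix.transpose_mul, Matrix.transpose_transpose, Matrix.mul_assoc, ← Matrix.mul_assoc Nᵀ,
    Matrix.mul_nonsing_inv _ hM, Matrix.mul_one]

/-! ### Law of large numbers and empirical Gram matrices -/

/-- The strong law of large numbers for uniformly distributed sample points. -/
lemma ae_tendsto_average_uniform {Ω : Type*} [MeasurableSpace Ω] {P : Measure Ω}
    [IsProbabilityMeasure P] {T : ℕ → Ω → ℝ} (hT : ∀ i, Measurable (T i))
    (hu : ∀ i, pdf.IsUniform (T i) (Set.Icc (0 : ℝ) 1) P volume) (hi : iIndepFun T P)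
    {f : ℝ → ℝ} (hf : Continuous f) :
    ∀ᵐ ω ∂P, Tendsto (fun n : ℕ => (∑ i : Fin n, f (T i ω)) / n) atTop
      (nhds (∫ t in (0 : ℝ)..1, f t)) := by
  have hlaw : ∀ i, P.map (T i) = volume.restrict (Set.Icc (0 : ℝ) 1) := fun i => by
    rw [hu i, ProbabilityTheory.cond]
    simp
  have hint : Integrable f (P.map (T 0)) := by
    rw [hlaw]
    exact hf.continuousOn.integrableOn_Icc
  have h := strong_law_ae_real (μ := P) (fun i ω => f (T i ω))
    (hint.comp_measurable (hT 0))
    (fun i j hij => (hi.indepFun hij).comp hf.measurable hf.measurable)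
    (fun i => IdentDistrib.comp ⟨(hT i).aemeasurable, (hT 0).aemeasurable, by rw [hlaw, hlaw]⟩
      hf.measurable)
  have he : ∫ ω, f (T 0 ω) ∂P = ∫ t in (0 : ℝ)..1, f t := by
    rw [← integral_map (hT 0).aemeasurable hf.aestronglyMeasurable, hlaw,
      integral_Icc_eq_integral_Ioc, intervalIntegral.integral_of_le zero_le_one]
  filter_upwards [h] with ω hω
  rw [he] at hω
  refine hω.congr fun n => ?_
  rw [Finset.sum_range]

lemma basisMatrix_mulVec (k m : ℕ) {n : ℕ} (t : Fin n → ℝ) (θ : Fin m → ℝ) (i : Fin n) :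
    (basisMatrix k m t *ᵥ θ) i = splineSum k m θ (t i) := rfl

lemma sum_sq_splineSum (k m : ℕ) {n : ℕ} (t : Fin n → ℝ) (θ : Fin m → ℝ) :
    ∑ i, splineSum k m θ (t i) ^ 2 = ∑ a, ∑ b, θ a * θ b *
      ∑ i, splineBasis k m a (t i) * splineBasis k m b (t i) := by
  simp only [splineSum, sq, Finset.sum_mul_sum]
  rw [Finset.sum_comm]
  refine Finset.sum_congr rfl fun a _ => ?_
  rw [Finset.sum_comm]
  simp only [Finset.mul_sum]
  exact Finset.sum_congr rfl fun b _ => Finset.sum_congr rfl fun i _ => by ring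

lemma integral_sq_splineSum {k m : ℕ} (hm : 0 < m) (hk : 0 < k) (θ : Fin m → ℝ) :
    ∫ t in (0 : ℝ)..1, splineSum k m θ t ^ 2 = ∑ a, ∑ b, θ a * θ b *
      ∫ t in (0 : ℝ)..1, splineBasis k m a t * splineBasis k m b t := by
  have hc := continuous_splineBasis hm hk
  simp only [splineSum, sq, Finset.sum_mul_sum]
  rw [intervalIntegral.integral_finsetSum fun a _ =>
    Continuous.intervalIntegrable (by fun_prop) _ _]
  refine Finset.sum_congr rfl fun a _ => ?_
  rw [intervalIntegral.integral_finsetSum fun b _ =>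
    Continuous.intervalIntegrable (by fun_prop) _ _]
  refine Finset.sum_congr rfl fun b _ => ?_
  rw [← intervalIntegral.integral_const_mul]
  congr 1
  ext t
  ring

/-- The empirical Gram matrices inherit half of a lower bound for the Gram matrix. -/
lemma eventually_le_sum_sq_splineSum {k m : ℕ} (hm : 0 < m) (hk : 0 < k) {c : ℝ} (hc : 0 < c)
    (hG : ∀ θ : Fin m → ℝ, c / m * ∑ s, θ s ^ 2 ≤ ∫ t in (0 : ℝ)..1, splineSum k m θ t ^ 2)
    {t : ℕ → ℝ} (ht : ∀ a b : Fin m, Tendsto (fun n : ℕ =>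
      (∑ i : Fin n, splineBasis k m a (t i) * splineBasis k m b (t i)) / n) atTop
        (nhds (∫ x in (0 : ℝ)..1, splineBasis k m a x * splineBasis k m b x))) :
    ∀ᶠ n : ℕ in atTop, ∀ θ : Fin m → ℝ, n * (c / (2 * m)) * ∑ s, θ s ^ 2 ≤
      ∑ i, (basisMatrix k m (fun i : Fin n => t i) *ᵥ θ) i ^ 2 := by
  have hm' : (0 : ℝ) < m := by exact_mod_cast hm
  -- Since (∑ |θ a|)² ≤ m ∑ θ s², entrywise accuracy c/(2m²) costs c/(2m), half of the Gram bound,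
  -- uniformly in θ.
  have hε : 0 < c / (2 * m ^ 2) := by positivity
  have h1 : ∀ᶠ n : ℕ in atTop, ∀ a b : Fin m,
      |(∑ i : Fin n, splineBasis k m a (t i) * splineBasis k m b (t i)) / n -
        ∫ x in (0 : ℝ)..1, splineBasis k m a x * splineBasis k m b x| < c / (2 * m ^ 2) := by
    rw [eventually_all]
    intro a
    rw [eventually_all]
    intro b
    exact Metric.tendsto_atTop'.1 (ht a b) _ hε |> fun ⟨n₀, hn₀⟩ =>
      (eventually_gt_atTop n₀).mono fun n hn => hn₀ n hn
  filter_upwards [h1, eventually_gt_atTop 0] with n hn hn0 θ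
  have hn' : (0 : ℝ) < n := by exact_mod_cast hn0
  simp only [basisMatrix_mulVec]
  have h2 : (∫ x in (0 : ℝ)..1, splineSum k m θ x ^ 2) -
      (∑ i : Fin n, splineSum k m θ (t i) ^ 2) / n ≤ c / (2 * m) * ∑ s, θ s ^ 2 := by
    rw [integral_sq_splineSum hm hk, sum_sq_splineSum, Finset.sum_div, ← Finset.sum_sub_distrib]
    calc _ ≤ ∑ a : Fin m, ∑ b : Fin m, |θ a| * |θ b| * (c / (2 * m ^ 2)) := by
          refine Finset.sum_le_sum fun a _ => ?_
          rw [Finset.sum_div, ← Finset.sum_sub_distrib]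
          refine Finset.sum_le_sum fun b _ => ?_
          rw [mul_div_assoc, ← mul_sub, ← abs_mul]
          refine (le_abs_self _).trans ?_
          rw [abs_mul, abs_sub_comm]
          gcongr
          exact (hn a b).le
      _ = (∑ a : Fin m, |θ a|) ^ 2 * (c / (2 * m ^ 2)) := by
          simp only [← Finset.sum_mul]
          rw [sq (∑ a : Fin m, |θ a|), Finset.sum_mul_sum]
      _ ≤ (m * ∑ s, θ s ^ 2) * (c / (2 * m ^ 2)) := by
          gcongr
          have := sq_sum_le_card_mul_sum_sq (s := Finset.univ) (f := fun a : Fin m => |θ a|)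
          simpa using this
      _ = _ := by field_simp
  have h3 := hG θ
  have h4 : c / (2 * m) * ∑ s, θ s ^ 2 ≤ (∑ i : Fin n, splineSum k m θ (t i) ^ 2) / n := by
    have : c / m * ∑ s, θ s ^ 2 = c / (2 * m) * ∑ s, θ s ^ 2 + c / (2 * m) * ∑ s, θ s ^ 2 := by
      field_simp
      ring
    linarith
  rw [le_div_iff₀ hn'] at h4
  linarith

/-- The average of the squared interpolation error over the sample points. -/
lemma eventually_sum_sq_le {w : ℝ → ℝ} {t : ℕ → ℝ} {B : ℝ}
    (ht : Tendsto (fun n : ℕ => (∑ i : Fin n, w (t i) ^ 2) / n) atTop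
      (nhds (∫ x in (0 : ℝ)..1, w x ^ 2))) (hB : ∫ x in (0 : ℝ)..1, w x ^ 2 < B) :
    ∀ᶠ n : ℕ in atTop, ∑ i : Fin n, w (t i) ^ 2 ≤ n * B := by
  filter_upwards [ht.eventually (gt_mem_nhds hB), eventually_gt_atTop 0] with n hn hn0
  have hn' : (0 : ℝ) < n := by exact_mod_cast hn0
  rw [div_lt_iff₀ hn'] at hn
  linarith

/-! ### Assembly of the estimates -/

lemma IsSplineInterpolant.integral_sq_sub_le' {k m : ℕ} (hm : 0 < m) (hk : Odd k) {u p : ℝ → ℝ}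
    (hu : Function.Periodic u 1) (hu' : ContDiff ℝ ((k + 1 : ℕ) : WithTop ℕ∞) u)
    (hp : IsSplineInterpolant k m u p) :
    ∫ t in (0 : ℝ)..1, (u t - p t) ^ 2 ≤ ((((k + 1) / 2 : ℕ) : ℝ) ^ (2 * (k + 1)) *
      ∫ t in (0 : ℝ)..1, iteratedDeriv (k + 1) u t ^ 2) * ((1 / (m : ℝ)) ^ (k + 1)) ^ 2 := by
  obtain ⟨q, rfl⟩ := hk
  refine (hp.integral_sq_sub_le hm hu hu').trans_eq ?_
  rw [← pow_mul, show (2 * q + 1 + 1) * 2 = 4 * (q + 1) by omega,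
    show 2 * (2 * q + 1 + 1) = 4 * (q + 1) by omega, show (2 * q + 1 + 1) / 2 = q + 1 by omega,
    div_pow, div_pow, one_pow]
  ring

/-- Bias and covariance of the least-squares estimator under Gaussian noise. -/
lemma lsEstimator_bounds {k m n : ℕ} {lam : ℝ} (hlam : 0 < lam) {t : Fin n → ℝ}
    (hN : ∀ θ : Fin m → ℝ, lam * ∑ s, θ s ^ 2 ≤ ∑ i, (basisMatrix k m t *ᵥ θ) i ^ 2)
    {y : Fin n → ℝ} {θ₀ : EuclideanSpace ℝ (Fin m)} {B : ℝ}
    (hB : ∑ i, (y i - splineSum k m θ₀ (t i)) ^ 2 ≤ B)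
    {Ω : Type*} [MeasurableSpace Ω] {Q : Measure Ω} [IsProbabilityMeasure Q] {v : ℝ≥0}
    {η : Fin n → Ω → ℝ} (hη : ∀ i, Measurable (η i)) (hl : ∀ i, Q.map (η i) = gaussianReal 0 v)
    (hi : iIndepFun η Q) {θhat : Ω → EuclideanSpace ℝ (Fin m)}
    (hθ : ∀ ω, θhat ω = lsEstimator k m t (fun i => y i + η i ω)) :
    MemLp θhat 2 Q ∧ lam * ‖(∫ ω, θhat ω ∂Q) - θ₀‖ ^ 2 ≤ B ∧
      matrixNorm2 (covMatrix Q θhat) ≤ v / lam := by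
  have hunit := isUnit_transpose_mul_self hlam hN
  have hdet := (Matrix.isUnit_iff_isUnit_det _).1 hunit
  obtain rfl : θhat = fun ω => WithLp.toLp 2 ((((basisMatrix k m t)ᵀ * basisMatrix k m t)⁻¹ *
      (basisMatrix k m t)ᵀ) *ᵥ fun i => y i + η i ω) := funext hθ
  refine ⟨memLp_affine_noise hη hl _ _, ?_, ?_⟩
  · rw [integral_affine_noise hη hl]
    -- Least squares reproduces θ₀ from N θ₀, so the bias is the least-squares solution for the
    -- residual y - N θ₀.
    have h1 := sum_sq_leastSquares_le hlam hN (y - basisMatrix k m t *ᵥ θ₀.ofLp)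
    rw [Matrix.mulVec_sub, Matrix.mulVec_mulVec, Matrix.mul_assoc, Matrix.nonsing_inv_mul _ hdet,
      Matrix.one_mulVec] at h1
    rw [EuclideanSpace.norm_sq_eq]
    simp only [Real.norm_eq_abs, sq_abs]
    exact h1.trans hB
  · rw [covMatrix_affine_noise hη hl hi, leastSquares_mul_transpose hunit]
    exact matrixNorm2_smul_inv_le hlam hN v.coe_nonneg

/-- The order of the quantifiers encodes the dependence of the constants: c₂ precedes u, c₁ precedes
r, and the noise comes after the threshold for n. -/
theorem mainTheorem2 (k : ℕ) (hk : Odd k) :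
    ∃ c₂ : ℝ, ∀ u : ℝ → ℝ, Function.Periodic u 1 → ContDiff ℝ ((k + 1 : ℕ) : WithTop ℕ∞) u →
      ∃ c₁ : ℝ, ∀ r : ℕ,
        (∃! p : ℝ → ℝ, IsSplineInterpolant k (r + k) u p) ∧
        ∃ θopt : EuclideanSpace ℝ (Fin (r + k)),
          (∀ θ : EuclideanSpace ℝ (Fin (r + k)),
            IsInterpolantCoeff k (r + k) u θ ↔ θ = θopt) ∧
          ∀ (Ω : Type*) [MeasurableSpace Ω] (P : Measure Ω) [IsProbabilityMeasure P]
            (T : ℕ → Ω → ℝ), (∀ i, Measurable (T i)) →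
            (∀ i, pdf.IsUniform (T i) (Set.Icc (0 : ℝ) 1) P volume) → iIndepFun T P →
            ∀ᵐ ω ∂P, ∀ᶠ n : ℕ in atTop,
              IsUnit ((basisMatrix k (r + k) (fun i : Fin n => T i ω))ᵀ *
                basisMatrix k (r + k) (fun i : Fin n => T i ω)) ∧
              ∀ (Ω' : Type*) [MeasurableSpace Ω'] (Q : Measure Ω') [IsProbabilityMeasure Q]
                (δ : ℝ≥0) (η : Fin n → Ω' → ℝ), (∀ i, Measurable (η i)) →
                (∀ i, Q.map (η i) = gaussianReal 0 (δ ^ 2)) → iIndepFun η Q →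
                ∀ θhat : Ω' → EuclideanSpace ℝ (Fin (r + k)),
                  (∀ ω', θhat ω' = lsEstimator k (r + k) (fun i : Fin n => T i ω)
                    (fun i : Fin n => u (T i ω) + η i ω')) →
                  MemLp θhat 2 Q ∧
                  ‖(∫ ω', θhat ω' ∂Q) - θopt‖ ≤
                    (c₁ * √((r + k : ℕ) : ℝ)) * (1 / ((r + k : ℕ) : ℝ)) ^ (k + 1) ∧
                  matrixNorm2 (covMatrix Q θhat) ≤
                    (c₂ * ((r + k : ℕ) : ℝ)) * ((δ : ℝ) ^ 2 / (n : ℝ)) := by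
  obtain ⟨c, hc, hG⟩ := exists_le_integral_sq_splineSum hk.pos
  refine ⟨2 / c, fun u hu hu' => ?_⟩
  set D : ℝ := (((k + 1) / 2 : ℕ) : ℝ) ^ (2 * (k + 1)) *
    ∫ t in (0 : ℝ)..1, iteratedDeriv (k + 1) u t ^ 2
  have hD0 : 0 ≤ D := mul_nonneg (by positivity)
    (intervalIntegral.integral_nonneg zero_le_one fun t _ => sq_nonneg _)
  -- D + 1 replaces D to make the bound on the L² error strict, so that the empirical averages
  -- eventually satisfy it. The factor 2/c is that of 1/λ = 2m/(cn).
  refine ⟨√(2 * (D + 1) / c), fun r => ?_⟩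
  have hm : 0 < r + k := by have := hk.pos; omega
  generalize r + k = m at hm ⊢
  have hm' : (0 : ℝ) < m := by exact_mod_cast hm
  obtain ⟨θ₀, hθ₀⟩ := exists_isSplineInterpolant_splineSum hm hk hu
  refine ⟨existsUnique_isSplineInterpolant hm hk hu, WithLp.toLp 2 θ₀,
    isInterpolantCoeff_iff hm hk hu hθ₀, ?_⟩
  intro Ω _ P _ T hT hTu hTi
  have hbasis := continuous_splineBasis hm hk.pos
  have hS := continuous_splineSum hm hk.pos θ₀
  have huc : Continuous u := hu'.continuous
  -- Only finitely many averages of functions of the locations must converge, so the null set and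
  -- the threshold for n do not involve the noise.
  have h1 : ∀ᵐ ω ∂P, ∀ a b : Fin m, Tendsto (fun n : ℕ =>
      (∑ i : Fin n, splineBasis k m a (T i ω) * splineBasis k m b (T i ω)) / n) atTop
        (nhds (∫ x in (0 : ℝ)..1, splineBasis k m a x * splineBasis k m b x)) :=
    ae_all_iff.2 fun a => ae_all_iff.2 fun b =>
      ae_tendsto_average_uniform hT hTu hTi ((hbasis a).mul (hbasis b))
  have h2 : ∀ᵐ ω ∂P, Tendsto (fun n : ℕ =>
      (∑ i : Fin n, (u (T i ω) - splineSum k m θ₀ (T i ω)) ^ 2) / n) atTop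
        (nhds (∫ x in (0 : ℝ)..1, (u x - splineSum k m θ₀ x) ^ 2)) :=
    ae_tendsto_average_uniform hT hTu hTi (f := fun x => (u x - splineSum k m θ₀ x) ^ 2)
      ((huc.sub hS).pow 2)
  have hE : ∫ x in (0 : ℝ)..1, (u x - splineSum k m θ₀ x) ^ 2 <
      (D + 1) * ((1 / (m : ℝ)) ^ (k + 1)) ^ 2 := by
    have h3 := hθ₀.integral_sq_sub_le' hm hk hu hu'
    have h5 : 0 < ((1 / (m : ℝ)) ^ (k + 1)) ^ 2 := by positivity
    linarith
  filter_upwards [h1, h2] with ω hω1 hω2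
  have hbound := eventually_sum_sq_le (w := fun x => u x - splineSum k m θ₀ x)
    (t := fun i => T i ω) hω2 hE
  have hgram := eventually_le_sum_sq_splineSum (t := fun i => T i ω) hm hk.pos hc (hG m hm) hω1
  filter_upwards [hgram, hbound, eventually_gt_atTop 0] with n hn1 hn2 hn0
  have hn' : (0 : ℝ) < n := by exact_mod_cast hn0
  have hlam : 0 < n * (c / (2 * m)) := by positivity
  refine ⟨isUnit_transpose_mul_self hlam hn1, ?_⟩
  intro Ω' _ Q _ δ η hη hηl hηi θhat hθhat
  obtain ⟨h3, h4, h5⟩ := lsEstimator_bounds (θ₀ := WithLp.toLp 2 θ₀) hlam hn1 hn2 hη hηl hηi hθhat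
  refine ⟨h3, ?_, h5.trans_eq ?_⟩
  · refine le_of_sq_le_sq ?_ (by positivity)
    rw [mul_pow, mul_pow, Real.sq_sqrt (by positivity), Real.sq_sqrt hm'.le]
    refine le_of_mul_le_mul_left (h4.trans_eq ?_) hlam
    field_simp
  · push_cast
    field_simp
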